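/- **Notation.** Let $t$ be an indeterminate, $\mathbf x=(x_1,x_2,\dots)$, $\mathbf y=(y_1,y_2,\dots)$, and define $q_n(\mathbf x)\in\mathbb Q(t)[\mathbf x]$ by $\sum_{n\ge 0}q_n(\mathbf x)z^n=\exp\bigl(\sum_{n\ge1}(1-t^n)x_nz^n\bigr)$ and $q_n=0$ for $n<0$. For integer sequences $\alpha=(\alpha_1,\dots,\alpha_l)$ and $\beta=(\beta_1,\dots,\beta_m)$ put $q_\alpha(\mathbf x)=\prod_i q_{\alpha_i}(\mathbf x)$ and $q_{[\alpha,\beta]}=q_\alpha(\mathbf x)\,q_\beta(\mathbf y)$. Let $R_{\alpha_i\alpha_j}$ raise $\alpha_i$ by $1$ and lower $\alpha_j$ by $1$, and let $D_{\alpha_i\beta_a}$ lower both $\alpha_i$ and $\beta_a$ by $1$. These operators act on formal symbols through their indices: rational expressions in them are expanded as power series in the operators, the resulting monomials act on the indices, and the symbols are evaluated afterwards (only finitely many terms are nonzero). For integer sequences define $$Q_\alpha(\mathbf x)=\prod_{i<j}\frac{1-R_{\alpha_i\alpha_j}}{1-tR_{\alpha_i\alpha_j}}\,q_\alpha(\mathbf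 x),$$ $$Q_{[\alpha,\beta]}(\mathbf x,\mathbf y)=\prod_{i<j}\frac{1-R_{\alpha_i\alpha_j}}{1-tR_{\alpha_i\alpha_j}}\prod_{a<b}\frac{1-R_{\beta_a\beta_b}}{1-tR_{\beta_a\beta_b}}\prod_{i,a}\frac{(1-D_{\alpha_i\beta_a})(1-t^2D_{\alpha_i\beta_a})}{(1-tD_{\alpha_i\beta_a})^2}\,q_{[\alpha,\beta]}.$$ For Young diagrams (partitions, identified with their sequences of positive parts) these are the Hall–Littlewood functions and the coupled Hall–Littlewood functions. Let $\tilde\partial_{\mathbf x}=(\partial_{x_1},\tfrac12\partial_{x_2},\tfrac13\partial_{x_3},\dots)$, and similarly $\tilde\partial_{\mathbf y}$. For $p\in\mathbb Q(t)[\mathbf x]$, $p(\mathbf x-\tilde\partial_{\mathbf y})$ and $p(\mathbf y-\tilde\partial_{\mathbf x})$ denote the operators on $\mathbb Q(t)[\mathbf x,\mathbf y]$ obtained by substituting for $x_n$ the (mutually commuting) operators $x_n-\tfrac1n\partial_{y_n}$, respectively $y_n-\tfrac1n\partial_{x_n}$. For integer sequences $\kappa,\nu,\theta,\eta$ put $$\Phi(\kappa,\nu,\theta,\eta)=\bigl(Q_\kappa(\mathbf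 x-\tilde\partial_{\mathbf y})\,Q_\nu(\mathbf x-\tilde\partial_{\mathbf y})\,Q_\theta(\mathbf y-\tilde\partial_{\mathbf x})\,Q_\eta(\mathbf y-\tilde\partial_{\mathbf x})\bigr)\cdot 1 .$$ **Proposition.** Let $\kappa,\theta,\nu,\eta$ be Young diagrams. Then there are unique finite expansions $Q_\kappa Q_\nu=\sum_\lambda f^\lambda_{\kappa\nu}Q_\lambda$ and $Q_\theta Q_\eta=\sum_\mu f^\mu_{\theta\eta}Q_\mu$ with coefficients in $\mathbb Q(t)$, where $\lambda,\mu$ run over Young diagrams, and $$Q_{[\kappa,\theta]}\,Q_{[\nu,\eta]}=\prod_{i,j}\frac{(1-tD_{\kappa_i\eta_j})^2}{(1-D_{\kappa_i\eta_j})(1-t^2D_{\kappa_i\eta_j})}\prod_{m,n}\frac{(1-tD_{\theta_m\nu_n})^2}{(1-D_{\theta_m\nu_n})(1-t^2D_{\theta_m\nu_n})}\;\Phi(\kappa,\nu,\theta,\eta),$$ where the operators $D$ act on the indices of the formal symbol $\Phi(\kappa,\nu,\theta,\eta)$, so that only finitely many monomials in them give a nonzero term, and $$\Phi(\kappa,\nu,\theta,\eta)=\sum_{\lambda,\mu}f^\lambda_{\kappa\nu}\,f^\mu_{\theta\eta}\,Q_{[\lambda,\mu]}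 .$$ -/

import Mathlib

open scoped PowerSeries

noncomputable section

namespace CoupledHL

/-- The coefficient field `ℚ(t)`. -/
abbrev K : Type := RatFunc ℚ

/-- The indeterminate `t` of `ℚ(t)`. -/
def t : K := RatFunc.X

/-- The ring `ℚ(t)[x₁, x₂, …]`. -/
abbrev Pol : Type := MvPolynomial ℕ+ K

/-- The ring `ℚ(t)[x₁, x₂, …, y₁, y₂, …]`; `x_n` is the variable `Sum.inl n` and `y_n` is the
variable `Sum.inr n`. -/
abbrev Pol₂ : Type := MvPolynomial (ℕ+ ⊕ ℕ+) K

/-- The series `ξ_t(x, z) = ∑_{n ≥ 1} (1 - tⁿ) x_n zⁿ`, in the variable `z`. -/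
def xi : Pol⟦X⟧ :=
  PowerSeries.mk fun n =>
    if h : 0 < n then MvPolynomial.C (1 - t ^ n) * MvPolynomial.X (⟨n, h⟩ : ℕ+) else 0

/-- `q_n(x)` is the coefficient of `zⁿ` in `exp (ξ_t(x, z))`, and `0` for `n < 0`. -/
def q : ℤ → Pol
  | Int.ofNat n => PowerSeries.coeff n (PowerSeries.subst xi (PowerSeries.exp Pol))
  | Int.negSucc _ => 0

/-- Formal operator calculus on index vectors. For a finite family of commuting shift operators
`S_e : a ↦ a + s e` of an index lattice `A` and power series `φ_e` in one variable over `ℚ(t)`,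
this is `∏_e φ_e(S_e)` applied to the formal symbol `F a`: the product is expanded into monomials
`∏_e S_e ^ (k e)`, these act on the index `a`, and only then is `F` evaluated. In every use below
only finitely many terms do not vanish. -/
def applyOps {ι A V : Type} [Fintype ι] [AddCommGroup A] [AddCommGroup V] [Module K V]
    (φ : ι → K⟦X⟧) (s : ι → A) (F : A → V) (a : A) : V :=
  ∑ᶠ k : ι → ℕ, (∏ e, PowerSeries.coeff (k e) (φ e)) • F (a + ∑ e, k e • s e)

/-- The series `(1 - u) / (1 - t u)`. -/
def raisingSeries : K⟦X⟧ :=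
  (1 - PowerSeries.X) * (1 - PowerSeries.C t * PowerSeries.X)⁻¹

/-- The series `(1 - u) (1 - t² u) / (1 - t u)²`. -/
def couplingSeries : K⟦X⟧ :=
  (1 - PowerSeries.X) * (1 - PowerSeries.C (t ^ 2) * PowerSeries.X) *
    ((1 - PowerSeries.C t * PowerSeries.X) ^ 2)⁻¹

/-- The series `(1 - t u)² / ((1 - u) (1 - t² u))`. -/
def decouplingSeries : K⟦X⟧ :=
  (1 - PowerSeries.C t * PowerSeries.X) ^ 2 *
    ((1 - PowerSeries.X) * (1 - PowerSeries.C (t ^ 2) * PowerSeries.X))⁻¹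

/-- The pairs `i < j` of positions. -/
abbrev Pairs (l : ℕ) : Type := {p : Fin l × Fin l // p.1 < p.2}

/-- The unit vector `e_i`. -/
def unitVec {l : ℕ} (i : Fin l) : Fin l → ℤ := Pi.single i 1

/-- The shift of `R_{ij}`: raise position `i` by one and lower position `j` by one. -/
def raise {l : ℕ} (p : Pairs l) : Fin l → ℤ := unitVec p.1.1 - unitVec p.1.2

/-- The Hall-Littlewood function `∏_{i<j} (1 - R_{ij}) / (1 - t R_{ij}) q_α(x)`, for any integer
sequence `α`. -/
def hlSeq {l : ℕ} (α : Fin l → ℤ) : Pol :=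
  applyOps (fun _ : Pairs l => raisingSeries) raise (fun β : Fin l → ℤ => ∏ i, q (β i)) α

/-- The formal symbol `q_{[α,β]}(x, y) = ∏ q_{α_i}(x) ∏ q_{β_a}(y)`. -/
def qPair {l m : ℕ} (a : (Fin l → ℤ) × (Fin m → ℤ)) : Pol₂ :=
  (∏ i, MvPolynomial.rename Sum.inl (q (a.1 i))) * ∏ j, MvPolynomial.rename Sum.inr (q (a.2 j))

/-- The coupled Hall-Littlewood function of a pair of integer sequences: the operators
`(1 - R) / (1 - t R)` for the pairs of positions in the first sequence and in the second one, and
`(1 - D) (1 - t² D) / (1 - t D)²`, where `D` lowers one position in each of the two sequences,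
applied to `q_{[α,β]}`. -/
def coupledSeq {l m : ℕ} (α : Fin l → ℤ) (β : Fin m → ℤ) : Pol₂ :=
  applyOps
    (Sum.elim (fun _ : Pairs l => raisingSeries)
      (Sum.elim (fun _ : Pairs m => raisingSeries) (fun _ : Fin l × Fin m => couplingSeries)))
    (Sum.elim (fun p => (raise p, 0))
      (Sum.elim (fun p => (0, raise p)) (fun d => (-unitVec d.1, -unitVec d.2))))
    qPair (α, β)

/-- The parts `(λ₁, …, λ_l)` of a Young diagram with `l` rows. -/
def parts (lam : YoungDiagram) : Fin (lam.colLen 0) → ℤ := fun i => (lam.rowLen i : ℤ)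

/-- The Hall-Littlewood function `Q_λ(x)`. -/
def Q (lam : YoungDiagram) : Pol := hlSeq (parts lam)

/-- The coupled Hall-Littlewood function `Q_{[λ,μ]}(x, y)`. -/
def coupledQ (lam mu : YoungDiagram) : Pol₂ := coupledSeq (parts lam) (parts mu)

/-- The coefficients `λ ↦ f^λ_{κν}` of the expansion `Q_κ Q_ν = ∑_λ f^λ_{κν} Q_λ`. -/
def structureConst (kap nu : YoungDiagram) : YoungDiagram →₀ K :=
  Classical.epsilon fun f => Finsupp.linearCombination K Q f = Q kap * Q nu

/-- The operator `X_{a(n)} - (1/n) ∂/∂X_{b(n)}` on `ℚ(t)[x, y]`. -/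
def shiftOp (a b : ℕ+ → ℕ+ ⊕ ℕ+) (n : ℕ+) : Module.End K Pol₂ :=
  LinearMap.mulLeft K (MvPolynomial.X (a n)) -
    ((n : ℕ) : K)⁻¹ • (MvPolynomial.pderiv (b n)).toLinearMap

lemma pderiv_comm (i j : ℕ+ ⊕ ℕ+) (p : Pol₂) :
    MvPolynomial.pderiv i (MvPolynomial.pderiv j p) =
      MvPolynomial.pderiv j (MvPolynomial.pderiv i p) := by
  have h : ⁅MvPolynomial.pderiv (R := K) i, MvPolynomial.pderiv (R := K) j⁆ = 0 := by
    classical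
    ext k
    simp [Derivation.commutator_apply, MvPolynomial.pderiv_X, Pi.single_apply, apply_ite]
  have := congrArg (fun D => D p) h
  simpa [Derivation.commutator_apply, sub_eq_zero] using this

lemma shiftOp_comm {a b : ℕ+ → ℕ+ ⊕ ℕ+} (hab : ∀ n m, a n ≠ b m) :
    ∀ u ∈ Set.range (shiftOp a b), ∀ v ∈ Set.range (shiftOp a b), u * v = v * u := by
  rintro _ ⟨n, rfl⟩ _ ⟨m, rfl⟩
  refine LinearMap.ext fun p => ?_
  simp only [shiftOp, Module.End.mul_apply, LinearMap.sub_apply, LinearMap.smul_apply,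
    LinearMap.mulLeft_apply, Derivation.coeFn_coe,
    MvPolynomial.pderiv_mul, MvPolynomial.pderiv_X_of_ne (hab _ _),
    pderiv_comm (b n) (b m) p, smul_sub, mul_sub, mul_smul_comm, zero_mul, zero_add,
    smul_comm ((n : ℕ) : K)⁻¹ ((m : ℕ) : K)⁻¹, mul_left_comm (MvPolynomial.X (a n))]
  abel

open scoped IsMulCommutative in
/-- Substitution of the commuting operators `X_{a(n)} - (1/n) ∂/∂X_{b(n)}` for the variables of a
polynomial. It is evaluation in the commutative algebra of operators that they generate. -/
def substOp (a b : ℕ+ → ℕ+ ⊕ ℕ+) (hab : ∀ n m, a n ≠ b m) : Pol →ₐ[K] Module.End K Pol₂ :=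
  have : IsMulCommutative (Algebra.adjoin K (Set.range (shiftOp a b))) :=
    Algebra.isMulCommutative_adjoin K (shiftOp_comm hab)
  (Algebra.adjoin K (Set.range (shiftOp a b))).val.comp
    (MvPolynomial.aeval fun n =>
      (⟨shiftOp a b n, Algebra.subset_adjoin ⟨n, rfl⟩⟩ :
        Algebra.adjoin K (Set.range (shiftOp a b))))

lemma substOp_X (a b : ℕ+ → ℕ+ ⊕ ℕ+) (hab : ∀ n m, a n ≠ b m) (n : ℕ+) :
    substOp a b hab (MvPolynomial.X n) = shiftOp a b n := by
  simp [substOp]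

/-- `p(x) ↦ p(x - ∂̃_y)`, where `∂̃_y = (∂/∂y₁, (1/2) ∂/∂y₂, (1/3) ∂/∂y₃, …)`. -/
def substX : Pol →ₐ[K] Module.End K Pol₂ := substOp Sum.inl Sum.inr (by simp)

/-- `p(x) ↦ p(y - ∂̃_x)`, where `∂̃_x = (∂/∂x₁, (1/2) ∂/∂x₂, (1/3) ∂/∂x₃, …)`. -/
def substY : Pol →ₐ[K] Module.End K Pol₂ := substOp Sum.inr Sum.inl (by simp)

/-- Quadruples of integer sequences, in the order `(κ, ν, θ, η)`. -/
abbrev Quad (k n m h : ℕ) : Type :=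
  (Fin k → ℤ) × (Fin n → ℤ) × (Fin m → ℤ) × (Fin h → ℤ)

/-- `(Q_κ(x - ∂̃_y) Q_ν(x - ∂̃_y) Q_θ(y - ∂̃_x) Q_η(y - ∂̃_x)) · 1`, for integer sequences. -/
def mixed {k n m h : ℕ} (a : Quad k n m h) : Pol₂ :=
  (substX (hlSeq a.1) * substX (hlSeq a.2.1) * substY (hlSeq a.2.2.1) * substY (hlSeq a.2.2.2)) 1

/-- The shifts of the operators `D_{κ_i η_j}` (left summand) and `D_{θ_m ν_n}` (right summand):
each lowers the two positions that it names by one. -/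
def crossShift {k n m h : ℕ} : (Fin k × Fin h) ⊕ (Fin m × Fin n) → Quad k n m h :=
  Sum.elim (fun d => (-unitVec d.1, 0, 0, -unitVec d.2))
    (fun d => (0, -unitVec d.2, -unitVec d.1, 0))

/-- The product of `(1 - t D)² / ((1 - D) (1 - t² D))` over all `D = D_{κ_i η_j}` and all
`D = D_{θ_m ν_n}`, applied to a formal symbol `F` with index `a = (κ, ν, θ, η)`. -/
def crossOps {k n m h : ℕ} (F : Quad k n m h → Pol₂) (a : Quad k n m h) : Pol₂ :=
  applyOps (fun _ => decouplingSeries) crossShift F a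

/-- The index vector `(κ, ν, θ, η)` of four Young diagrams. -/
def quadParts (kap nu the eta : YoungDiagram) :
    Quad (kap.colLen 0) (nu.colLen 0) (the.colLen 0) (eta.colLen 0) :=
  (parts kap, parts nu, parts the, parts eta)

end CoupledHL

end

/-! Both sides of the product formula are products of power series in commuting index shifts,
applied to one symbol `qQuad`, namely q_κ(x) q_ν(x) q_θ(y) q_η(y). A weight that drops under every
shift and is nonnegative wherever the symbol survives makes all sums finite, so operators compose by
multiplying their series (`applyOps_mul`). The formula then reduces to comparing the series attached
to each shift.

The analytic input is `substX_q_mul`: moving q_n(x - ∂̃_y) past q_m(y) produces the coupling series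
in the simultaneous lowering of n and m. It comes from `vertexSeries_mul`, where both sides solve
the same first-order differential equation in z. Iteration gives `substX_prod_q`, and linearity
gives `mixed_eq`: Φ carries a coupling factor for every pair of an x-position and a y-position. The
product of coupled functions carries one only for the pairs (κ,θ) and (ν,η)
(`coupledSeq_mul_coupledSeq`). The decoupling series, inverse to the coupling series, cancels the
factors of the pairs (κ,η) and (ν,θ) (`crossOps_mixed`).

With two of the four sequences empty, `mixed_eq` becomes Q_λ(x - ∂̃_y) Q_μ(y - ∂̃_x) · 1 = Q_[λ,μ]
(`substX_hlSeq_substY_hlSeq`). As `substX` and `substY` are algebra homomorphisms, expanding Q_κ Q_ν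
and Q_θ Q_η inside Φ gives the second formula. The structure constants are well defined because the
Q_λ form a basis: the q_n with n ≥ 1 are free polynomial generators, and Q_λ is q_λ plus terms of
the same size with a larger sum of squared parts (`exists_higherTerms`). -/

noncomputable section

namespace CoupledHL

/-! ### Formal operator calculus on an index lattice. -/

section Operators

variable {ι ι' A B V W : Type} [Fintype ι] [Fintype ι'] [AddCommGroup A] [AddCommGroup B]
  [AddCommGroup V] [AddCommGroup W]

/-- Every shift strictly lowers the weight `w`. -/
def Lowers (w : A →+ ℤ) (s : ι → A) : Prop := ∀ e, w (s e) < 0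

/-- The symbol `F` vanishes on indices of negative weight. -/
def BoundedBy (w : A →+ ℤ) (F : A → V) : Prop := ∀ a, F a ≠ 0 → 0 ≤ w a

/-- Weights are integers, so each application of a shift costs at least one unit; this bounds the
total number of applications. -/
lemma Lowers.weight_add_sum_le {w : A →+ ℤ} {s : ι → A} (hs : Lowers w s) (a : A) (k : ι → ℕ) :
    w (a + ∑ e, k e • s e) + ∑ e, (k e : ℤ) ≤ w a := by
  have : ∑ e, (k e : ℤ) * w (s e) + ∑ e, (k e : ℤ) ≤ 0 := by
    rw [← Finset.sum_add_distrib]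
    refine Finset.sum_nonpos fun e _ => ?_
    have := hs e
    nlinarith [Int.natCast_nonneg (k e)]
  simp only [map_add, map_sum, map_nsmul, nsmul_eq_mul]
  linarith

lemma Lowers.weight_le {w : A →+ ℤ} {s : ι → A} (hs : Lowers w s) (a : A) (k : ι → ℕ) :
    w (a + ∑ e, k e • s e) ≤ w a := by
  have := hs.weight_add_sum_le a k
  have : 0 ≤ ∑ e, (k e : ℤ) := Finset.sum_nonneg fun _ _ => Int.natCast_nonneg _
  linarith

-- A single cube of exponents contains all contributions. As weights only decrease, the same N also
-- serves every shifted index, which is what composing two operators needs.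
open scoped Classical in
lemma BoundedBy.mem_box {w : A →+ ℤ} {s : ι → A} {F : A → V} (hF : BoundedBy w F)
    (hs : Lowers w s) {a : A} {N : ℕ} (hN : w a < N) {k : ι → ℕ}
    (hk : F (a + ∑ e, k e • s e) ≠ 0) : k ∈ Fintype.piFinset fun _ : ι => Finset.range N := by
  have h₁ := hF _ hk
  have h₂ := hs.weight_add_sum_le a k
  simp only [Fintype.mem_piFinset, Finset.mem_range]
  intro e
  have : (k e : ℤ) ≤ ∑ e, (k e : ℤ) :=
    Finset.single_le_sum (f := fun e => (k e : ℤ)) (fun _ _ => Int.natCast_nonneg _)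
      (Finset.mem_univ e)
  omega

lemma BoundedBy.finite {w : A →+ ℤ} {s : ι → A} {F : A → V} (hF : BoundedBy w F)
    (hs : Lowers w s) (a : A) : {k : ι → ℕ | F (a + ∑ e, k e • s e) ≠ 0}.Finite := by
  classical
  refine (Finset.finite_toSet (Fintype.piFinset fun _ : ι =>
    Finset.range ((w a).toNat + 1))).subset fun k hk => ?_
  exact hF.mem_box hs (N := (w a).toNat + 1) (by omega) hk

variable [Module K V] [Module K W]

open scoped Classical in
lemma applyOps_eq_sum {w : A →+ ℤ} {s : ι → A} {F : A → V} (hF : BoundedBy w F)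
    (hs : Lowers w s) (φ : ι → K⟦X⟧) {a : A} {N : ℕ} (hN : w a < N) :
    applyOps φ s F a = ∑ k ∈ Fintype.piFinset fun _ : ι => Finset.range N,
      (∏ e, PowerSeries.coeff (k e) (φ e)) • F (a + ∑ e, k e • s e) := by
  refine finsum_eq_sum_of_support_subset _ fun k hk => ?_
  exact hF.mem_box hs hN (right_ne_zero_of_smul hk)

lemma BoundedBy.applyOps {w : A →+ ℤ} {s : ι → A} {F : A → V} (hF : BoundedBy w F)
    (hs : Lowers w s) (φ : ι → K⟦X⟧) : BoundedBy w (applyOps φ s F) := by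
  intro a ha
  obtain ⟨k, hk⟩ : ∃ k : ι → ℕ,
      (∏ e, PowerSeries.coeff (k e) (φ e)) • F (a + ∑ e, k e • s e) ≠ 0 := by
    by_contra! h
    exact ha (finsum_eq_zero_of_forall_eq_zero h)
  exact (hF _ (right_ne_zero_of_smul hk)).trans (hs.weight_le a k)

lemma applyOps_congr {φ : ι → K⟦X⟧} {s : ι → A} {F G : A → V} (h : ∀ a, F a = G a) (a : A) :
    applyOps φ s F a = applyOps φ s G a := by
  rw [funext h]

/-- Restriction to the operators whose series is not `1`. -/
lemma applyOps_restrict (j : ι' → ι) (hj : Function.Injective j) (φ : ι → K⟦X⟧) (s : ι → A)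
    (F : A → V) (hφ : ∀ e, e ∉ Set.range j → φ e = 1) (a : A) :
    applyOps φ s F a = applyOps (φ ∘ j) (s ∘ j) F a := by
  classical
  let g : (ι' → ℕ) → ι → ℕ := fun k => Function.extend j k 0
  have hgj : ∀ k e, g k (j e) = k e := fun k e => hj.extend_apply _ _ _
  have hg0 : ∀ k e, e ∉ Set.range j → g k e = 0 := fun k e he =>
    Function.extend_apply' _ _ _ (by simpa using he)
  have hg : Function.Injective g := fun k l hkl => by
    funext e
    rw [← hgj k, ← hgj l, hkl]
  unfold applyOps
  rw [← finsum_mem_univ, ← finsum_mem_inter_support, Set.univ_inter]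
  -- A nonzero coefficient of the series 1 forces exponent zero, so every contributing exponent
  -- vector is an extension by zero.
  have hsupp : Function.support (fun k : ι → ℕ =>
      (∏ e, PowerSeries.coeff (k e) (φ e)) • F (a + ∑ e, k e • s e)) ⊆ Set.range g := by
    intro k hk
    refine ⟨k ∘ j, ?_⟩
    funext e
    by_cases he : e ∈ Set.range j
    · obtain ⟨e, rfl⟩ := he
      simp [hgj]
    · rw [hg0 _ _ he]
      have := Finset.prod_ne_zero_iff.1 (left_ne_zero_of_smul hk) e (Finset.mem_univ e)
      rw [hφ e he, PowerSeries.coeff_one] at this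
      by_contra h
      exact this (if_neg fun h' => h h'.symm)
  rw [← Set.inter_eq_self_of_subset_right hsupp, finsum_mem_inter_support, finsum_mem_range hg]
  refine finsum_congr fun k => ?_
  congr 1
  · refine (Fintype.prod_of_injective j hj _ _ (fun e he => ?_) fun e => ?_).symm
    · simp [hg0 _ _ he, hφ e he]
    · simp [hgj]
  · congr 2
    refine (Fintype.sum_of_injective j hj _ _ (fun e he => ?_) fun e => ?_).symm
    · simp [hg0 _ _ he]
    · simp [hgj]

lemma applyOps_one (s : ι → A) (F : A → V) (a : A) : applyOps (fun _ => 1) s F a = F a := by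
  rw [applyOps_restrict (ι' := Empty) Empty.elim (fun e => e.elim) _ _ _ fun _ _ => rfl]
  unfold applyOps
  rw [finsum_unique]
  simp

/-- Transport along a homomorphism of index lattices followed by a translation. -/
lemma applyOps_map (g : A →+ B) (b : B) (φ : ι → K⟦X⟧) (s : ι → A) (s' : ι → B)
    (hs : ∀ e, g (s e) = s' e) (F : B → V) (a : A) :
    applyOps φ s (fun a => F (g a + b)) a = applyOps φ s' F (g a + b) := by
  unfold applyOps
  refine finsum_congr fun k => ?_
  rw [add_right_comm]
  simp only [map_add, map_sum, map_nsmul, hs]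

/-- A linear map that does not depend on the indices moved by the operators may be applied before
or after them. -/
lemma applyOps_linear {w : A →+ ℤ} {s : ι → A} {F : A → V} (hF : BoundedBy w F)
    (hs : Lowers w s) (φ : ι → K⟦X⟧) (Λ : A → V →ₗ[K] W)
    (hΛ : ∀ e, φ e ≠ 1 → ∀ a, Λ (a + s e) = Λ a) (a : A) :
    Λ a (applyOps φ s F a) = applyOps φ s (fun b => Λ b (F b)) a := by
  unfold applyOps
  rw [map_finsum (Λ a)]
  swap
  · exact (hF.finite hs a).subset fun k hk => right_ne_zero_of_smul hk
  refine finsum_congr fun k => ?_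
  rw [map_smul]
  by_cases hk : ∏ e, PowerSeries.coeff (k e) (φ e) = 0
  · simp [hk]
  congr 2
  -- Shifts carrying the series 1 do not occur in a nonzero term, so invariance of Λ is needed only
  -- for the others.
  have hk0 : ∀ e, φ e = 1 → k e = 0 := fun e he => by
    have := Finset.prod_ne_zero_iff.1 hk e (Finset.mem_univ e)
    rw [he, PowerSeries.coeff_one] at this
    by_contra h
    exact this (if_neg h)
  have hn : ∀ e, φ e ≠ 1 → ∀ (n : ℕ) b, Λ (b + n • s e) = Λ b := by
    intro e he n
    induction n with
    | zero => simp
    | succ n ih => intro b; rw [succ_nsmul, ← add_assoc, hΛ e he, ih]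
  have hS : ∀ S : Finset ι, Λ (a + ∑ e ∈ S, k e • s e) = Λ a := by
    classical
    intro S
    induction S using Finset.induction_on with
    | empty => simp
    | insert e S he ih =>
      rw [Finset.sum_insert he, add_comm (k e • s e), ← add_assoc]
      by_cases h : φ e = 1
      · simp [hk0 e h, ih]
      · rw [hn e h, ih]
  exact (hS _).symm

/-- Operators compose by multiplication of their series. -/
lemma applyOps_mul {w : A →+ ℤ} {s : ι → A} {F : A → V} (hF : BoundedBy w F)
    (hs : Lowers w s) (φ ψ : ι → K⟦X⟧) (a : A) :
    applyOps φ s (applyOps ψ s F) a = applyOps (φ * ψ) s F a := by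
  classical
  obtain ⟨N, hN⟩ : ∃ N : ℕ, w a < N := ⟨(w a).toNat + 1, by omega⟩
  rw [applyOps_eq_sum (hF.applyOps hs ψ) hs φ hN, applyOps_eq_sum hF hs _ hN]
  have h₁ : ∀ k : ι → ℕ, applyOps ψ s F (a + ∑ e, k e • s e) =
      ∑ l ∈ Fintype.piFinset fun _ : ι => Finset.range N,
        (∏ e, PowerSeries.coeff (l e) (ψ e)) • F (a + ∑ e, (k + l) e • s e) := by
    intro k
    rw [applyOps_eq_sum hF hs ψ ((hs.weight_le a k).trans_lt hN)]
    refine Finset.sum_congr rfl fun l _ => ?_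
    simp only [Pi.add_apply, add_smul, Finset.sum_add_distrib, add_assoc]
  simp only [h₁, Pi.mul_apply, PowerSeries.coeff_mul, Finset.prod_univ_sum, Finset.sum_smul,
    Finset.smul_sum, smul_smul]
  rw [← Finset.sum_product', Finset.sum_sigma']
  symm
  -- The Cauchy product is indexed by a total exponent and its splittings. Each splitting is a pair
  -- (k, l) in the box; a pair missed this way has k + l outside the box, where the symbol vanishes.
  refine Finset.sum_of_injOn (fun x => (fun e => (x.2 e).1, fun e => (x.2 e).2)) ?_ ?_ ?_ ?_
  · rintro ⟨k, p⟩ hx ⟨k', p'⟩ hx' h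
    simp only [Finset.coe_sigma, Set.mem_sigma_iff, Finset.mem_coe, Fintype.mem_piFinset,
      Finset.HasAntidiagonal.mem_antidiagonal, Prod.mk.injEq] at hx hx' h
    have hp : p = p' := by
      funext e
      exact Prod.ext (congrFun h.1 e) (congrFun h.2 e)
    subst hp
    have : k = k' := by
      funext e
      rw [← hx.2 e, ← hx'.2 e]
    subst this
    rfl
  · rintro ⟨k, p⟩ hx
    simp only [Finset.coe_sigma, Set.mem_sigma_iff, Finset.mem_coe, Fintype.mem_piFinset,
      Finset.HasAntidiagonal.mem_antidiagonal, Finset.mem_range, Finset.mem_product] at hx ⊢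
    exact ⟨fun e => by have := hx.1 e; have := hx.2 e; omega,
      fun e => by have := hx.1 e; have := hx.2 e; omega⟩
  · rintro ⟨k, l⟩ hx hnot
    by_contra h
    have hbox := hF.mem_box hs hN (right_ne_zero_of_smul h)
    apply hnot
    refine ⟨⟨k + l, fun e => (k e, l e)⟩, ?_, rfl⟩
    simpa using hbox
  · rintro ⟨k, p⟩ hx
    simp only [Finset.mem_sigma, Fintype.mem_piFinset, Finset.HasAntidiagonal.mem_antidiagonal] at hx
    have : k = (fun e => (p e).1) + fun e => (p e).2 := by
      funext e
      exact (hx.2 e).symm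
    simp only [this, Finset.prod_mul_distrib]

/-- A single operator. -/
lemma applyOps_single (s : ι → A) (F : A → V) (φ : ι → K⟦X⟧) (e : ι)
    (hφ : ∀ d, d ≠ e → φ d = 1) (a : A) :
    applyOps φ s F a = ∑ᶠ n : ℕ, PowerSeries.coeff n (φ e) • F (a + n • s e) := by
  rw [applyOps_restrict (ι' := Unit) (fun _ => e) (fun _ _ _ => rfl) φ s F
    (fun d hd => hφ d fun h => hd ⟨(), h.symm⟩)]
  unfold applyOps
  rw [← finsum_comp_equiv (Equiv.funUnique Unit ℕ).symm]
  refine finsum_congr fun n => ?_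
  simp

end Operators

open Finset.HasAntidiagonal (antidiagonal mem_antidiagonal)

/-! ### Derivations on power series and uniqueness for first-order equations. -/

section SeriesCalculus

variable {R : Type} [CommRing R] [Algebra K R]

lemma natCast_succ_ne_zero (n : ℕ) : ((n : K) + 1) ≠ 0 := by
  exact_mod_cast Nat.succ_ne_zero n

lemma t_pow_ne_one {n : ℕ} (hn : n ≠ 0) : t ^ n ≠ 1 := by
  intro h
  have h' : (algebraMap (Polynomial ℚ) K) (Polynomial.X ^ n) = algebraMap (Polynomial ℚ) K 1 := by
    simpa [t] using h
  have := congrArg Polynomial.natDegree (RatFunc.algebraMap_injective ℚ h')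
  simp [hn] at this

/-- A series without constant term whose derivative vanishes to the order to which the series
itself does is zero. -/
lemma eq_zero_of_derivative (P : R⟦X⟧) (h0 : PowerSeries.coeff 0 P = 0)
    (h : ∀ n, (∀ i ≤ n, PowerSeries.coeff i P = 0) →
      PowerSeries.coeff n (PowerSeries.derivative R P) = 0) : P = 0 := by
  have key : ∀ n, ∀ i ≤ n, PowerSeries.coeff i P = 0 := by
    intro n
    induction n with
    | zero => intro i hi; rwa [Nat.le_zero.1 hi]
    | succ n ih =>
      intro i hi
      rcases Nat.lt_or_ge i (n + 1) with h' | h'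
      · exact ih i (by omega)
      · obtain rfl : i = n + 1 := by omega
        have h1 := h n ih
        rw [PowerSeries.coeff_derivative] at h1
        have h2 : ((n : K) + 1) • PowerSeries.coeff (n + 1) P = 0 := by
          rw [Algebra.smul_def, mul_comm]
          simpa using h1
        exact (smul_eq_zero_iff_right (natCast_succ_ne_zero n)).1 h2
  ext n
  simpa using key n n le_rfl

/-- The derivation of power series that applies a derivation to the coefficients. -/
def coeffDeriv (d : Derivation K R R) (P : R⟦X⟧) : R⟦X⟧ :=
  PowerSeries.mk fun n => d (PowerSeries.coeff n P)

lemma coeffDeriv_mul (d : Derivation K R R) (P S : R⟦X⟧) :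
    coeffDeriv d (P * S) = coeffDeriv d P * S + P * coeffDeriv d S := by
  ext n
  simp only [coeffDeriv, PowerSeries.coeff_mk, map_add, PowerSeries.coeff_mul, map_sum,
    Derivation.leibniz, smul_eq_mul, Finset.sum_add_distrib]
  rw [add_comm]
  congr 1
  exact Finset.sum_congr rfl fun _ _ => mul_comm _ _

/-- The operator `∑_j X^j d_j` on power series. -/
def seriesDeriv (d : ℕ → Derivation K R R) (P : R⟦X⟧) : R⟦X⟧ :=
  PowerSeries.mk fun n => ∑ p ∈ antidiagonal n, d p.2 (PowerSeries.coeff p.1 P)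

/-- Up to order N only the derivations with j ≤ N contribute. Truncation to a finite sum makes the
Leibniz rule available. -/
lemma coeff_seriesDeriv_eq_of_le (d : ℕ → Derivation K R R) (P : R⟦X⟧) {n N : ℕ} (h : n ≤ N) :
    PowerSeries.coeff n (seriesDeriv d P) = PowerSeries.coeff n
      (∑ j ∈ Finset.range (N + 1), PowerSeries.X ^ j * coeffDeriv (d j) P) := by
  rw [map_sum, seriesDeriv, PowerSeries.coeff_mk,
    Finset.Nat.sum_antidiagonal_eq_sum_range_succ_mk, ← Finset.sum_range_reflect]
  simp only [PowerSeries.coeff_X_pow_mul', coeffDeriv, PowerSeries.coeff_mk]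
  rw [← Finset.sum_filter]
  refine Finset.sum_congr ?_ fun j hj => ?_
  · ext j
    simp only [Finset.mem_range, Finset.mem_filter]
    omega
  · have := (Finset.mem_filter.1 hj).2
    have h1 : n + 1 - 1 - j = n - j := by omega
    have h2 : n - (n - j) = j := by omega
    simp only [h1, h2]

lemma seriesDeriv_mul (d : ℕ → Derivation K R R) (P S : R⟦X⟧) :
    seriesDeriv d (P * S) = seriesDeriv d P * S + P * seriesDeriv d S := by
  ext n
  have h1 : ∑ p ∈ antidiagonal n, PowerSeries.coeff p.1 (seriesDeriv d P) *
      PowerSeries.coeff p.2 S = ∑ p ∈ antidiagonal n, PowerSeries.coeff p.1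
        (∑ j ∈ Finset.range (n + 1), PowerSeries.X ^ j * coeffDeriv (d j) P) *
          PowerSeries.coeff p.2 S :=
    Finset.sum_congr rfl fun p hp => by
      rw [coeff_seriesDeriv_eq_of_le d P (Finset.HasAntidiagonal.antidiagonal.fst_le hp)]
  have h2 : ∑ p ∈ antidiagonal n, PowerSeries.coeff p.1 P *
      PowerSeries.coeff p.2 (seriesDeriv d S) = ∑ p ∈ antidiagonal n, PowerSeries.coeff p.1 P *
        PowerSeries.coeff p.2
          (∑ j ∈ Finset.range (n + 1), PowerSeries.X ^ j * coeffDeriv (d j) S) :=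
    Finset.sum_congr rfl fun p hp => by
      rw [coeff_seriesDeriv_eq_of_le d S (Finset.HasAntidiagonal.antidiagonal.snd_le hp)]
  rw [coeff_seriesDeriv_eq_of_le d _ le_rfl, map_add, PowerSeries.coeff_mul,
    PowerSeries.coeff_mul, h1, h2]
  rw [← PowerSeries.coeff_mul, ← PowerSeries.coeff_mul, ← map_add, Finset.sum_mul,
    Finset.mul_sum, ← Finset.sum_add_distrib]
  congr 1
  refine Finset.sum_congr rfl fun j _ => ?_
  rw [coeffDeriv_mul]
  ring

end SeriesCalculus

/-! ### The coupling series and its logarithmic derivative. -/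

section Coupling

/-- The geometric series `1 / (1 - r u)`. -/
def geom (r : K) : K⟦X⟧ := PowerSeries.mk fun n => r ^ n

lemma geom_mul (r : K) : geom r * (1 - PowerSeries.C r * PowerSeries.X) = 1 := by
  ext n
  rw [mul_sub, mul_one, map_sub, mul_left_comm, PowerSeries.coeff_C_mul]
  cases n with
  | zero => simp [geom]
  | succ n =>
    rw [PowerSeries.coeff_succ_mul_X, PowerSeries.coeff_one]
    simp [geom, pow_succ']

lemma inv_one_sub (r : K) : (1 - PowerSeries.C r * PowerSeries.X)⁻¹ = geom r :=
  ((PowerSeries.eq_inv_iff_mul_eq_one (by simp)).2 (geom_mul r)).symm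

lemma derivative_geom (r : K) :
    PowerSeries.derivative K (geom r) = PowerSeries.C r * geom r ^ 2 := by
  rw [← inv_one_sub, PowerSeries.derivative_inv']
  simp
  ring

lemma coupling_mul_decoupling : decouplingSeries * couplingSeries = 1 := by
  have h1 : (((1 : K⟦X⟧) - PowerSeries.C t * PowerSeries.X) ^ 2)⁻¹ *
      (1 - PowerSeries.C t * PowerSeries.X) ^ 2 = 1 := PowerSeries.inv_mul_cancel _ (by simp)
  have h2 : (((1 : K⟦X⟧) - PowerSeries.X) * (1 - PowerSeries.C (t ^ 2) * PowerSeries.X))⁻¹ *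
      ((1 - PowerSeries.X) * (1 - PowerSeries.C (t ^ 2) * PowerSeries.X)) = 1 :=
    PowerSeries.inv_mul_cancel _ (by simp)
  rw [decouplingSeries, couplingSeries]
  calc _ = ((((1 : K⟦X⟧) - PowerSeries.C t * PowerSeries.X) ^ 2)⁻¹ *
      (1 - PowerSeries.C t * PowerSeries.X) ^ 2) *
      ((((1 : K⟦X⟧) - PowerSeries.X) * (1 - PowerSeries.C (t ^ 2) * PowerSeries.X))⁻¹ *
      ((1 - PowerSeries.X) * (1 - PowerSeries.C (t ^ 2) * PowerSeries.X))) := by ring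
    _ = 1 := by rw [h1, h2, one_mul]

lemma coupling_eq : couplingSeries = (1 - PowerSeries.X) *
    (1 - PowerSeries.C (t ^ 2) * PowerSeries.X) * geom t ^ 2 := by
  rw [couplingSeries]
  congr 1
  refine ((PowerSeries.eq_inv_iff_mul_eq_one (by simp)).2 ?_).symm
  rw [← mul_pow, geom_mul, one_pow]

lemma constantCoeff_coupling : PowerSeries.coeff 0 couplingSeries = 1 := by
  simp [coupling_eq, geom]

/-- The logarithm of the series is -∑ (1 - 2tⁿ + t²ⁿ) uⁿ/n = -∑ (1 - tⁿ)² uⁿ/n. The square is what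
two factors 1 - tⁿ, one from the operator and one from differentiating q, will produce. -/
lemma derivative_coupling : PowerSeries.derivative K couplingSeries =
    -(PowerSeries.mk fun n => (1 - t ^ (n + 1)) ^ 2) * couplingSeries := by
  have hM : (PowerSeries.mk fun n => (1 - t ^ (n + 1)) ^ 2 : K⟦X⟧) =
      geom 1 - PowerSeries.C (2 * t) * geom t + PowerSeries.C (t ^ 2) * geom (t ^ 2) := by
    ext n
    simp only [geom, map_add, map_sub, PowerSeries.coeff_C_mul, PowerSeries.coeff_mk]
    ring
  have h1 := geom_mul 1
  have h2 := geom_mul (t ^ 2)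
  rw [map_one, one_mul] at h1
  rw [hM, coupling_eq]
  simp only [Derivation.leibniz, Derivation.leibniz_pow, derivative_geom, map_sub,
    PowerSeries.derivative_X, PowerSeries.derivative_C, Derivation.map_one_eq_zero, smul_eq_mul,
    nsmul_eq_mul, Nat.cast_ofNat, map_mul, map_ofNat, Nat.add_one_sub_one, pow_one]
  simp only [map_pow] at h2 ⊢
  linear_combination ((1 - PowerSeries.C t ^ 2 * PowerSeries.X) * geom t ^ 2) * h1 +
    (PowerSeries.C t ^ 2 * (1 - PowerSeries.X) * geom t ^ 2) * h2

end Coupling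

/-! ### Recursion and partial derivatives of the q_n. -/

section QSeries

/-- The variable `x_{j+1}`. -/
abbrev xVar (j : ℕ) : Pol := MvPolynomial.X j.succPNat

/-- The generating series of the `q_n`. -/
def qSeries : Pol⟦X⟧ := PowerSeries.subst xi (PowerSeries.exp Pol)

lemma q_natCast (n : ℕ) : q n = PowerSeries.coeff n qSeries := rfl

lemma q_neg {n : ℤ} (hn : n < 0) : q n = 0 := by
  obtain ⟨m, rfl⟩ := Int.eq_negSucc_of_lt_zero hn
  rfl

lemma constantCoeff_xi : PowerSeries.constantCoeff xi = 0 := by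
  simp [xi, ← PowerSeries.coeff_zero_eq_constantCoeff_apply]

lemma hasSubst_xi : PowerSeries.HasSubst xi :=
  PowerSeries.HasSubst.of_constantCoeff_zero' constantCoeff_xi

lemma q_zero : q 0 = 1 := by
  rw [show (0 : ℤ) = ((0 : ℕ) : ℤ) from rfl, q_natCast, PowerSeries.coeff_zero_eq_constantCoeff,
    qSeries, ← sub_add_cancel (PowerSeries.exp Pol) 1, PowerSeries.subst_add hasSubst_xi, map_add,
    ← PowerSeries.coe_substAlgHom hasSubst_xi, map_one, map_one, PowerSeries.coe_substAlgHom]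
  exact (add_eq_right).2 (PowerSeries.constantCoeff_subst_eq_zero constantCoeff_xi _ (by simp))

lemma derivative_qSeries : PowerSeries.derivative Pol qSeries =
    qSeries * PowerSeries.derivative Pol xi := by
  rw [qSeries, PowerSeries.derivative_subst hasSubst_xi, PowerSeries.derivative_exp]

lemma coeff_derivative_xi (n : ℕ) : PowerSeries.coeff n (PowerSeries.derivative Pol xi) =
    (((n : K) + 1) * (1 - t ^ (n + 1))) • xVar n := by
  rw [PowerSeries.coeff_derivative, xi, PowerSeries.coeff_mk, dif_pos n.succ_pos]
  rw [MvPolynomial.smul_eq_C_mul, MvPolynomial.C_mul, xVar,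
    show (⟨n + 1, n.succ_pos⟩ : ℕ+) = n.succPNat from rfl]
  simp only [map_add, map_natCast, map_one]
  exact mul_comm (G := Pol) _ _ |>.trans (mul_assoc (G := Pol) _ _ _).symm

/-- Compares coefficients in q' = q ξ'. The recursion is polynomial, so it survives the substitution
of operators for the variables. -/
lemma newton (n : ℕ) : ((n : K) + 1) • q (n + 1 : ℕ) = ∑ p ∈ antidiagonal n,
    (((p.2 : K) + 1) * (1 - t ^ (p.2 + 1))) • (xVar p.2 * q p.1) := by
  have h := congrArg (PowerSeries.coeff n) derivative_qSeries
  rw [PowerSeries.coeff_derivative, PowerSeries.coeff_mul] at h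
  simp only [q_natCast]
  rw [Algebra.smul_def, mul_comm]
  convert h using 1
  · simp
  · refine Finset.sum_congr rfl fun p _ => ?_
    rw [coeff_derivative_xi, mul_comm (xVar _), mul_smul_comm]

lemma derivative_coeffDeriv {R : Type} [CommRing R] [Algebra K R] (d : Derivation K R R)
    (P : R⟦X⟧) : PowerSeries.derivative R (coeffDeriv d P) =
      coeffDeriv d (PowerSeries.derivative R P) := by
  ext n
  simp only [coeffDeriv, PowerSeries.coeff_derivative, PowerSeries.coeff_mk, Derivation.leibniz,
    map_add, Derivation.map_natCast, Derivation.map_one_eq_zero, smul_eq_mul, add_zero, mul_zero,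
    zero_add]
  ring

lemma coeffDeriv_derivative_xi (k : ℕ) :
    coeffDeriv (MvPolynomial.pderiv k.succPNat) (PowerSeries.derivative Pol xi) =
      PowerSeries.C (MvPolynomial.C (((k : K) + 1) * (1 - t ^ (k + 1)))) * PowerSeries.X ^ k := by
  ext1 n
  rw [PowerSeries.coeff_C_mul, PowerSeries.coeff_X_pow, coeffDeriv, PowerSeries.coeff_mk,
    coeff_derivative_xi, Derivation.map_smul, MvPolynomial.smul_eq_C_mul]
  split_ifs with h
  · subst h
    rw [MvPolynomial.pderiv_X_self]
  · rw [MvPolynomial.pderiv_X_of_ne (fun h' => h (Nat.succPNat_injective h')), mul_zero, mul_zero]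

/-- The difference P of the two sides satisfies P' = P ξ' and has no constant term, hence vanishes.
-/
lemma coeffDeriv_qSeries (k : ℕ) : coeffDeriv (MvPolynomial.pderiv k.succPNat) qSeries =
    PowerSeries.C (MvPolynomial.C (1 - t ^ (k + 1))) * PowerSeries.X ^ (k + 1) * qSeries := by
  rw [← sub_eq_zero]
  set P := coeffDeriv (MvPolynomial.pderiv k.succPNat) qSeries -
    PowerSeries.C (MvPolynomial.C (1 - t ^ (k + 1))) * PowerSeries.X ^ (k + 1) * qSeries with hP
  have hD : PowerSeries.derivative Pol P = P * PowerSeries.derivative Pol xi := by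
    rw [hP, map_sub, derivative_coeffDeriv, derivative_qSeries, coeffDeriv_mul,
      coeffDeriv_derivative_xi]
    simp only [Derivation.leibniz, Derivation.leibniz_pow, PowerSeries.derivative_C,
      PowerSeries.derivative_X, derivative_qSeries, smul_eq_mul, nsmul_eq_mul, map_mul, map_add,
      map_natCast, map_one, Nat.add_sub_cancel, Nat.cast_add, Nat.cast_one]
    ring
  refine eq_zero_of_derivative P ?_ fun n hn => ?_
  · have h1 : PowerSeries.coeff 0 qSeries = 1 := q_zero
    rw [hP, map_sub, mul_assoc, PowerSeries.coeff_C_mul, PowerSeries.coeff_X_pow_mul']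
    simp only [coeffDeriv, PowerSeries.coeff_mk, h1]
    simp
  · rw [hD, PowerSeries.coeff_mul]
    refine Finset.sum_eq_zero fun p hp => ?_
    rw [hn _ (Finset.HasAntidiagonal.antidiagonal.fst_le hp), zero_mul]

lemma pderiv_q (k : ℕ) (m : ℤ) : MvPolynomial.pderiv k.succPNat (q m) =
    (1 - t ^ (k + 1)) • q (m - (k + 1 : ℕ)) := by
  rcases lt_or_ge m 0 with hm | hm
  · rw [q_neg hm, q_neg (by omega)]
    simp
  · lift m to ℕ using hm
    have h := congrArg (PowerSeries.coeff m) (coeffDeriv_qSeries k)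
    rw [mul_assoc, PowerSeries.coeff_C_mul, PowerSeries.coeff_X_pow_mul'] at h
    rw [q_natCast, MvPolynomial.smul_eq_C_mul]
    simp only [coeffDeriv, PowerSeries.coeff_mk] at h
    rw [h]
    split_ifs with hk
    · rw [← q_natCast, Nat.cast_sub hk]
    · rw [q_neg (by omega)]

end QSeries

/-! ### Commutation of q_n(x - ∂̃_y) with q_m(y). -/

section Vertex

lemma substX_X (n : ℕ+) : substX (MvPolynomial.X n) = shiftOp Sum.inl Sum.inr n :=
  substOp_X _ _ _ n

/-- `q_n(y)`. -/
abbrev qY (n : ℤ) : Pol₂ := MvPolynomial.rename Sum.inr (q n)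

/-- `q_n(x)`. -/
abbrev qX (n : ℤ) : Pol₂ := MvPolynomial.rename Sum.inl (q n)

/-- The generating series of `q_n(x - ∂̃_y) g`. -/
def vertexSeries (g : Pol₂) : Pol₂⟦X⟧ := PowerSeries.mk fun n => substX (q n) g

/-- The derivations `(1 - t^{j+1}) ∂/∂y_{j+1}`. -/
def scaledPderiv (j : ℕ) : Derivation K Pol₂ Pol₂ :=
  (1 - t ^ (j + 1)) • MvPolynomial.pderiv (Sum.inr j.succPNat)

/-- The series `∑_j (j + 1) (1 - t^{j+1}) x_{j+1} z^j`. -/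
def xSeries : Pol₂⟦X⟧ := PowerSeries.mk fun j =>
  (((j : K) + 1) * (1 - t ^ (j + 1))) • MvPolynomial.X (Sum.inl j.succPNat)

/-- This is `newton` with operators substituted: multiplication by x_{j+1} gives the first term, and
the factor 1/(j+1) of the derivative cancels the j+1 of the recursion in the second. -/
lemma derivative_vertexSeries (g : Pol₂) : PowerSeries.derivative Pol₂ (vertexSeries g) =
    vertexSeries g * xSeries - seriesDeriv scaledPderiv (vertexSeries g) := by
  ext1 n
  rw [PowerSeries.coeff_derivative, map_sub, PowerSeries.coeff_mul, seriesDeriv,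
    PowerSeries.coeff_mk, ← Finset.sum_sub_distrib]
  have h := congrArg (fun p => substX p g) (newton n)
  simp only [map_smul, map_sum, map_mul, LinearMap.smul_apply, LinearMap.sum_apply,
    Module.End.mul_apply, substX_X] at h
  rw [vertexSeries, PowerSeries.coeff_mk]
  calc _ = ((n : K) + 1) • substX (q (n + 1 : ℕ)) g := by
        rw [Algebra.smul_def, mul_comm]; simp
    _ = _ := by
      rw [h]
      refine Finset.sum_congr rfl fun p _ => ?_
      simp only [shiftOp, LinearMap.sub_apply, LinearMap.smul_apply, LinearMap.mulLeft_apply,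
        Derivation.coeFn_coe, smul_sub, smul_smul, xSeries, PowerSeries.coeff_mk, scaledPderiv,
        Derivation.smul_apply]
      congr 1
      · rw [mul_smul_comm, mul_comm (MvPolynomial.X _)]
      · congr 1
        have := natCast_succ_ne_zero p.2
        simp only [Nat.succPNat_coe, Nat.succ_eq_add_one, Nat.cast_add, Nat.cast_one]
        field_simp

/-- The series `∑_j c_j q_{m-j}(y) z^j`, where `c_j` are the coefficients of the coupling
series. -/
def coupledShift (m : ℤ) : Pol₂⟦X⟧ :=
  PowerSeries.mk fun j => PowerSeries.coeff j couplingSeries • qY (m - j)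

/-- Differentiating q_{m-i}(y) by y_{j+1} gives an index depending only on i + j, so the sum
collapses to the convolution of (1 - t^{j+1})² with the coupling coefficients, known from
`derivative_coupling`. -/
lemma seriesDeriv_coupledShift (m : ℤ) : seriesDeriv scaledPderiv (coupledShift m) =
    -PowerSeries.derivative Pol₂ (coupledShift m) := by
  ext1 n
  have hc := congrArg (PowerSeries.coeff n) derivative_coupling
  rw [PowerSeries.coeff_derivative, neg_mul, map_neg, PowerSeries.coeff_mul] at hc
  rw [map_neg, PowerSeries.coeff_derivative, seriesDeriv, coupledShift, PowerSeries.coeff_mk,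
    PowerSeries.coeff_mk]
  have h1 : ∀ p ∈ antidiagonal n, scaledPderiv p.2 (PowerSeries.coeff p.1 (PowerSeries.mk fun j =>
      PowerSeries.coeff j couplingSeries • qY (m - j))) =
      ((1 - t ^ (p.2 + 1)) ^ 2 * PowerSeries.coeff p.1 couplingSeries) •
        qY (m - (n + 1 : ℕ)) := by
    intro p hp
    rw [PowerSeries.coeff_mk, scaledPderiv, Derivation.smul_apply, Derivation.map_smul, qY,
      MvPolynomial.pderiv_rename Sum.inr_injective, pderiv_q, map_smul, smul_smul, smul_smul]
    have : m - (p.1 : ℤ) - (p.2 + 1 : ℕ) = m - (n + 1 : ℕ) := by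
      have := mem_antidiagonal.1 hp
      omega
    rw [this]
    congr 1
    ring
  rw [Finset.sum_congr rfl h1, ← Finset.sum_smul]
  have h2 : ∑ p ∈ antidiagonal n, (1 - t ^ (p.2 + 1)) ^ 2 * PowerSeries.coeff p.1 couplingSeries =
      -(PowerSeries.coeff (n + 1) couplingSeries * ((n : K) + 1)) := by
    rw [hc, neg_neg, ← Finset.Nat.sum_antidiagonal_swap]
    simp
  rw [h2, neg_smul, mul_comm, mul_smul, Algebra.smul_def]
  simp [mul_comm]

/-- Write δ for `seriesDeriv scaledPderiv`. Both sides solve F' = F · `xSeries` - δF: for the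
product, the Leibniz rule combines with δC = -C' for C = `coupledShift m`. Both have constant term g
q_m(y), and the equation determines the higher coefficients. -/
lemma vertexSeries_mul (g : Pol₂) (m : ℤ) :
    vertexSeries (g * qY m) = vertexSeries g * coupledShift m := by
  rw [← sub_eq_zero]
  set P := vertexSeries (g * qY m) - vertexSeries g * coupledShift m with hP
  have hsub : seriesDeriv scaledPderiv P = seriesDeriv scaledPderiv (vertexSeries (g * qY m)) -
      seriesDeriv scaledPderiv (vertexSeries g * coupledShift m) := by
    ext1 n
    simp only [hP, seriesDeriv, PowerSeries.coeff_mk, map_sub, Finset.sum_sub_distrib]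
  have hD : PowerSeries.derivative Pol₂ P = P * xSeries - seriesDeriv scaledPderiv P := by
    rw [hsub, seriesDeriv_mul, seriesDeriv_coupledShift, hP, map_sub, derivative_vertexSeries,
      Derivation.leibniz, derivative_vertexSeries, smul_eq_mul, smul_eq_mul]
    ring
  refine eq_zero_of_derivative P ?_ fun n hn => ?_
  · have h0 : ∀ f, PowerSeries.coeff 0 (vertexSeries f) = f := fun f => by
      rw [vertexSeries, PowerSeries.coeff_mk, Nat.cast_zero, q_zero, map_one, Module.End.one_apply]
    rw [hP, map_sub, h0, PowerSeries.coeff_mul]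
    simp only [Finset.HasAntidiagonal.antidiagonal_zero, Finset.sum_singleton, h0]
    rw [coupledShift, PowerSeries.coeff_mk, constantCoeff_coupling]
    simp
  · rw [hD, map_sub, PowerSeries.coeff_mul, seriesDeriv, PowerSeries.coeff_mk,
      ← Finset.sum_sub_distrib]
    refine Finset.sum_eq_zero fun p hp => ?_
    rw [hn _ (Finset.HasAntidiagonal.antidiagonal.fst_le hp), zero_mul, map_zero, sub_zero]

/-- The commutation relation between `q_n(x - ∂̃_y)` and multiplication by `q_m(y)`. -/
lemma substX_q_mul (n m : ℤ) (g : Pol₂) : substX (q n) (g * qY m) =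
    ∑ᶠ j : ℕ, PowerSeries.coeff j couplingSeries • (substX (q (n - j)) g * qY (m - j)) := by
  rcases lt_or_ge n 0 with hn | hn
  · rw [q_neg hn, map_zero, LinearMap.zero_apply, finsum_eq_zero_of_forall_eq_zero]
    intro j
    rw [q_neg (by omega), map_zero, LinearMap.zero_apply, zero_mul, smul_zero]
  · lift n to ℕ using hn
    have h := congrArg (PowerSeries.coeff n) (vertexSeries_mul g m)
    rw [PowerSeries.coeff_mul, vertexSeries, PowerSeries.coeff_mk] at h
    rw [h, Finset.Nat.sum_antidiagonal_eq_sum_range_succ_mk, ← Finset.sum_range_reflect,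
      finsum_eq_sum_of_support_subset (s := Finset.range (n + 1))]
    · refine Finset.sum_congr rfl fun j hj => ?_
      have := Finset.mem_range.1 hj
      have h1 : n + 1 - 1 - j = n - j := by omega
      have h2 : n - (n - j) = j := by omega
      simp only [h1, h2, vertexSeries, coupledShift, PowerSeries.coeff_mk, mul_smul_comm]
      rw [Nat.cast_sub (by omega)]
    · intro j hj
      by_contra h'
      simp only [Finset.coe_range, Set.mem_Iio, not_lt] at h'
      apply hj
      simp only
      rw [q_neg (by omega), map_zero, LinearMap.zero_apply, zero_mul, smul_zero]

end Vertex

/-! ### Operators acting on polynomials in one family of variables. -/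

section Vacuum

lemma pderiv_rename_of_notMem {σ τ : Type} {a : σ → τ} {b : τ} (h : ∀ n, a n ≠ b)
    (f : MvPolynomial σ K) : MvPolynomial.pderiv b (MvPolynomial.rename a f) = 0 := by
  classical
  refine MvPolynomial.pderiv_eq_zero_of_notMem_vars fun hb => ?_
  obtain ⟨n, _, hn⟩ := Finset.mem_image.1 (MvPolynomial.vars_rename a f hb)
  exact h n hn

/-- The derivatives involve only the other family of variables, so on this subring the operators
reduce to multiplication. -/
lemma substOp_rename (a b : ℕ+ → ℕ+ ⊕ ℕ+) (hab : ∀ n m, a n ≠ b m) (p f : Pol) :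
    substOp a b hab p (MvPolynomial.rename a f) = MvPolynomial.rename a (p * f) := by
  induction p using MvPolynomial.induction_on generalizing f with
  | C c =>
    rw [← MvPolynomial.algebraMap_eq, AlgHom.commutes, Module.algebraMap_end_apply,
      MvPolynomial.algebraMap_eq, ← MvPolynomial.smul_eq_C_mul, map_smul]
  | add p₁ p₂ h₁ h₂ => rw [map_add, LinearMap.add_apply, h₁, h₂, add_mul, map_add]
  | mul_X p n h =>
    rw [map_mul, Module.End.mul_apply, substOp_X, shiftOp, LinearMap.sub_apply,
      LinearMap.smul_apply, Derivation.coeFn_coe, pderiv_rename_of_notMem (fun m => hab m n),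
      smul_zero, sub_zero, LinearMap.mulLeft_apply, ← MvPolynomial.rename_X, ← map_mul, h,
      mul_assoc]

lemma substX_rename (p f : Pol) :
    substX p (MvPolynomial.rename Sum.inl f) = MvPolynomial.rename Sum.inl (p * f) :=
  substOp_rename _ _ _ p f

lemma substY_one (p : Pol) : substY p 1 = MvPolynomial.rename Sum.inr p := by
  have := substOp_rename Sum.inr Sum.inl (by simp) p 1
  rwa [map_one, mul_one] at this

end Vacuum

/-! ### Products of q-functions over finite index types. -/

section SequenceProducts

variable {I J : Type} [Fintype I] [Fintype J]

/-- `∏ q_{α_i}(x) ∏ q_{β_j}(y)` for sequences indexed by arbitrary finite types. -/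
def qProd (a : (I → ℤ) × (J → ℤ)) : Pol₂ := (∏ i, qX (a.1 i)) * ∏ j, qY (a.2 j)

/-- The sum of all entries. -/
def sumWeight : (I → ℤ) × (J → ℤ) →+ ℤ where
  toFun a := ∑ i, a.1 i + ∑ j, a.2 j
  map_zero' := by simp
  map_add' a b := by
    simp only [Prod.fst_add, Prod.snd_add, Pi.add_apply, Finset.sum_add_distrib]
    ring

lemma nonneg_of_q_ne_zero {n : ℤ} (h : q n ≠ 0) : 0 ≤ n := by
  by_contra hn
  exact h (q_neg (not_le.1 hn))

lemma nonneg_of_prod_rename_q_ne_zero {L : Type} [Fintype L] {τ : Type} {f : ℕ+ → τ} {α : L → ℤ}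
    (h : ∏ i, MvPolynomial.rename f (q (α i)) ≠ 0) (i : L) : 0 ≤ α i := by
  refine nonneg_of_q_ne_zero fun h0 => h ?_
  exact Finset.prod_eq_zero (Finset.mem_univ i) (by rw [h0, map_zero])

lemma boundedBy_qProd : BoundedBy sumWeight (qProd : (I → ℤ) × (J → ℤ) → Pol₂) := by
  intro a ha
  exact add_nonneg
    (Finset.sum_nonneg fun i _ => nonneg_of_prod_rename_q_ne_zero (left_ne_zero_of_mul ha) i)
    (Finset.sum_nonneg fun i _ => nonneg_of_prod_rename_q_ne_zero (right_ne_zero_of_mul ha) i)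

end SequenceProducts

/-! ### Normal ordering of products of operators. -/

section NormalOrder

variable {I J : Type} [Fintype J] [DecidableEq I] [DecidableEq J]

/-- The shift that lowers one position in each of two sequences. -/
def dShift (d : I × J) : (I → ℤ) × (J → ℤ) := (-Pi.single d.1 1, -Pi.single d.2 1)

/-- The commutation of one operator `q_n(x - ∂̃_y)` past a product of `q_m(y)`. -/
lemma substX_q_mul_prod (i₀ : I) (g : (I → ℤ) × (J → ℤ) → Pol₂)
    (hg : ∀ j a, g (a + dShift (i₀, j)) = g a) (T : Finset J) (a : (I → ℤ) × (J → ℤ)) :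
    substX (q (a.1 i₀)) (g a * ∏ j ∈ T, qY (a.2 j)) * ∏ j ∈ Tᶜ, qY (a.2 j) =
      applyOps (fun j => if j ∈ T then couplingSeries else 1) (fun j => dShift (i₀, j))
        (fun b => substX (q (b.1 i₀)) (g b) * ∏ j, qY (b.2 j)) a := by
  -- The single entry at i₀ suffices as weight: each shift lowers it, and the operator vanishes once
  -- it is negative, whatever g is.
  let w : (I → ℤ) × (J → ℤ) →+ ℤ := (Pi.evalAddMonoidHom _ i₀).comp (AddMonoidHom.fst _ _)
  have hw : Lowers w (fun j : J => dShift (i₀, j)) := fun j => by simp [w, dShift]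
  have hF : BoundedBy w (fun b : (I → ℤ) × (J → ℤ) =>
      substX (q (b.1 i₀)) (g b) * ∏ j, qY (b.2 j)) := by
    intro b hb
    refine nonneg_of_q_ne_zero fun (h0 : q (b.1 i₀) = 0) => hb ?_
    simp only
    rw [h0, map_zero, LinearMap.zero_apply, zero_mul]
  -- T indexes the y-factors still inside the argument of the operator; the others have already been
  -- moved out.
  induction T using Finset.induction_on generalizing a with
  | empty => simp [applyOps_one]
  | insert j₀ T hj ih =>
    have hφ : (fun j => if j ∈ insert j₀ T then couplingSeries else 1) =
        (fun j => if j = j₀ then couplingSeries else 1) *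
          (fun j => if j ∈ T then couplingSeries else 1) := by
      funext j
      by_cases h : j = j₀
      · subst h; simp [hj]
      · simp [h]
    have hgn : ∀ n : ℕ, g (a + n • dShift (i₀, j₀)) = g a := by
      intro n
      induction n with
      | zero => simp
      | succ n ih => rw [succ_nsmul, ← add_assoc, hg, ih]
    rw [hφ, ← applyOps_mul hF hw, applyOps_congr fun b => (ih b).symm,
      applyOps_single _ _ _ j₀ (fun d hd => if_neg hd), if_pos rfl, Finset.prod_insert hj,
      mul_comm (qY _), ← mul_assoc, substX_q_mul, finsum_mul']
    · refine finsum_congr fun n => ?_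
      have h1 : (a + n • dShift (i₀, j₀)).1 i₀ = a.1 i₀ - n := by simp [dShift, sub_eq_add_neg]
      have h2 : (a + n • dShift (i₀, j₀)).2 j₀ = a.2 j₀ - n := by simp [dShift, sub_eq_add_neg]
      have h3 : ∀ j, j ≠ j₀ → (a + n • dShift (i₀, j₀)).2 j = a.2 j := fun j h => by
        simp [dShift, h]
      have hc : Tᶜ = insert j₀ (insert j₀ T)ᶜ := by
        ext j
        by_cases h : j = j₀
        · subst h; simp [hj]
        · simp [h]
      rw [smul_mul_assoc, h1, hgn, hc, Finset.prod_insert (by simp), h2, mul_assoc]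
      have e1 : ∏ j ∈ T, qY ((a + n • dShift (i₀, j₀)).2 j) = ∏ j ∈ T, qY (a.2 j) :=
        Finset.prod_congr rfl fun j hjT => by rw [h3 j fun h => hj (h ▸ hjT)]
      have e2 : ∏ j ∈ (insert j₀ T)ᶜ, qY ((a + n • dShift (i₀, j₀)).2 j) =
          ∏ j ∈ (insert j₀ T)ᶜ, qY (a.2 j) :=
        Finset.prod_congr rfl fun j hjT => by
          rw [h3 j fun h => by simp [h] at hjT]
      rw [e1, e2]
    · refine (Set.finite_Iic (a.1 i₀).toNat).subset fun n hn => ?_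
      have : 0 ≤ a.1 i₀ - n := nonneg_of_q_ne_zero fun h0 => hn (by
        simp only
        rw [h0, map_zero, LinearMap.zero_apply, zero_mul, smul_zero])
      simp only [Set.mem_Iic]
      omega

variable [Fintype I]

lemma lowers_dShift : Lowers sumWeight (dShift : I × J → _) := by
  intro d
  simp [sumWeight, dShift]

/-- Induction on the set S of positions that are operators rather than plain x-factors. The operator
at a new position passes all y-factors, then acts on the remaining x-factors by multiplication. -/
lemma substX_prod_q_partial (S : Finset I) (a : (I → ℤ) × (J → ℤ)) :
    substX (∏ i ∈ S, q (a.1 i)) ((∏ i ∈ Sᶜ, qX (a.1 i)) * ∏ j, qY (a.2 j)) =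
      applyOps (fun d : I × J => if d.1 ∈ S then couplingSeries else 1) dShift qProd a := by
  induction S using Finset.induction_on generalizing a with
  | empty =>
    simp only [Finset.prod_empty, map_one, Module.End.one_apply, Finset.compl_empty,
      Finset.notMem_empty, if_false, applyOps_one]
    rfl
  | insert i₀ S hi ih =>
    have hφ : (fun d : I × J => if d.1 ∈ insert i₀ S then couplingSeries else 1) =
        (fun d => if d.1 = i₀ then couplingSeries else 1) *
          (fun d => if d.1 ∈ S then couplingSeries else 1) := by
      funext d
      by_cases h : d.1 = i₀
      · simp [h, hi]
      · simp [h]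
    have hne : ∀ i, i ≠ i₀ → ∀ (j : J) (b : (I → ℤ) × (J → ℤ)),
        (b + dShift (i₀, j)).1 i = b.1 i := fun i h j b => by simp [dShift, h]
    have hc : Sᶜ = insert i₀ (insert i₀ S)ᶜ := by
      ext i
      by_cases h : i = i₀
      · subst h; simp [hi]
      · simp [h]
    rw [hφ, ← applyOps_mul boundedBy_qProd lowers_dShift, applyOps_congr fun b => (ih b).symm,
      applyOps_restrict (fun j : J => (i₀, j)) (fun _ _ h => (Prod.ext_iff.1 h).2) _ _ _
        (fun d hd => if_neg fun h => hd ⟨d.2, Prod.ext h.symm rfl⟩)]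
    have hinner := substX_q_mul_prod i₀ (fun b : (I → ℤ) × (J → ℤ) =>
      ∏ i ∈ (insert i₀ S)ᶜ, qX (b.1 i)) (fun j b => Finset.prod_congr rfl fun i h => by
        rw [hne i fun h' => by simp [h'] at h]) Finset.univ a
    simp only [Finset.mem_univ, if_true, Finset.compl_univ, Finset.prod_empty, mul_one] at hinner
    rw [Finset.prod_insert hi, mul_comm (q _), map_mul substX, Module.End.mul_apply, hinner]
    let w : (I → ℤ) × (J → ℤ) →+ ℤ := (Pi.evalAddMonoidHom _ i₀).comp (AddMonoidHom.fst _ _)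
    have hw : Lowers w (fun j : J => dShift (i₀, j)) := fun j => by simp [w, dShift]
    -- The shifts at i₀ leave the positions in S alone, so the operators at S can be moved inside
    -- the sum.
    rw [applyOps_linear (w := w) ?_ hw (fun _ => couplingSeries)
      (fun b : (I → ℤ) × (J → ℤ) => substX (∏ i ∈ S, q (b.1 i)))]
    · simp only [Function.comp_def, if_true]
      refine applyOps_congr (fun b => ?_) a
      rw [hc, Finset.prod_insert (by simp)]
      simp only [← map_prod]
      rw [substX_rename, ← map_mul]
    · intro j _ b
      congr 1
      exact Finset.prod_congr rfl fun i h => by rw [hne i fun h' => hi (h' ▸ h)]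
    · intro b hb
      refine nonneg_of_q_ne_zero fun (h0 : q (b.1 i₀) = 0) => hb ?_
      simp only
      rw [h0, map_zero, LinearMap.zero_apply, zero_mul]

/-- Normal ordering: `∏ q_{α_i}(x - ∂̃_y) ∏ q_{β_j}(y)` is obtained from `q_{[α,β]}` by the
coupling operators of all pairs of positions. -/
lemma substX_prod_q (a : (I → ℤ) × (J → ℤ)) :
    substX (∏ i, q (a.1 i)) (∏ j, qY (a.2 j)) =
      applyOps (fun _ : I × J => couplingSeries) dShift qProd a := by
  have := substX_prod_q_partial Finset.univ a
  simpa using this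

end NormalOrder

/-! ### Pulling operators out of Hall–Littlewood functions. -/

section HallLittlewood

/-- The weight `∑ (i + 1) α_i`, which every raising operator lowers. -/
def posWeight {l : ℕ} : (Fin l → ℤ) →+ ℤ where
  toFun α := ∑ i : Fin l, (((i : ℕ) : ℤ) + 1) * α i
  map_zero' := by simp
  map_add' α β := by simp only [Pi.add_apply, mul_add, Finset.sum_add_distrib]

lemma posWeight_unitVec {l : ℕ} (i : Fin l) : posWeight (unitVec i) = ((i : ℕ) : ℤ) + 1 := by
  simp [posWeight, unitVec, Pi.single_apply]

lemma posWeight_raise_neg {l : ℕ} (p : Pairs l) : posWeight (raise p) < 0 := by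
  have : (p.1.1 : ℕ) < p.1.2 := p.2
  rw [raise, map_sub, posWeight_unitVec, posWeight_unitVec]
  omega

lemma posWeight_neg_unitVec {l : ℕ} (i : Fin l) : posWeight (-unitVec i) < 0 := by
  rw [map_neg, posWeight_unitVec]
  omega

lemma posWeight_nonneg {l : ℕ} {α : Fin l → ℤ} (h : ∀ i, 0 ≤ α i) : 0 ≤ posWeight α :=
  Finset.sum_nonneg (s := Finset.univ) (f := fun i : Fin l => (((i : ℕ) : ℤ) + 1) * α i)
    fun i _ => mul_nonneg (by positivity) (h i)

lemma boundedBy_prod_q {l : ℕ} : BoundedBy posWeight (fun α : Fin l → ℤ => ∏ i, q (α i)) := by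
  intro α hα
  exact posWeight_nonneg fun i => nonneg_of_q_ne_zero fun h0 =>
    hα (Finset.prod_eq_zero (Finset.mem_univ i) h0)

variable {A V : Type} [AddCommGroup A] [AddCommGroup V] [Module K V]

/-- The raising operators may be pulled out of a linear expression in a Hall-Littlewood function. -/
lemma map_hlSeq {l : ℕ} (π : A →+ (Fin l → ℤ)) (s : Pairs l → A) (hs : ∀ p, π (s p) = raise p)
    (Λ : A → Pol →ₗ[K] V) (hΛ : ∀ p a, Λ (a + s p) = Λ a) (a : A) :
    Λ a (hlSeq (π a)) = applyOps (fun _ => raisingSeries) s (fun b => Λ b (∏ i, q (π b i))) a := by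
  have h := applyOps_map π 0 (fun _ => raisingSeries) s raise hs
    (fun α : Fin l → ℤ => ∏ i, q (α i)) a
  simp only [add_zero] at h
  rw [hlSeq, ← h]
  refine applyOps_linear (w := posWeight.comp π) (fun b hb => boundedBy_prod_q _ hb) (fun p => ?_)
    _ Λ (fun p _ => hΛ p) a
  simpa [hs] using posWeight_raise_neg p

/-- The operators of `Q_{[α,β]}`. -/
abbrev PairOps (l m : ℕ) : Type := Pairs l ⊕ Pairs m ⊕ (Fin l × Fin m)

/-- The series of the operators of `Q_{[α,β]}`. -/
def pairSeries {l m : ℕ} : PairOps l m → K⟦X⟧ :=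
  Sum.elim (fun _ => raisingSeries) (Sum.elim (fun _ => raisingSeries) (fun _ => couplingSeries))

/-- The shifts of the operators of `Q_{[α,β]}`. -/
def pairShift {l m : ℕ} : PairOps l m → (Fin l → ℤ) × (Fin m → ℤ) :=
  Sum.elim (fun p => (raise p, 0))
    (Sum.elim (fun p => (0, raise p)) (fun d => (-unitVec d.1, -unitVec d.2)))

lemma coupledSeq_eq {l m : ℕ} (a : (Fin l → ℤ) × (Fin m → ℤ)) :
    coupledSeq a.1 a.2 = applyOps pairSeries pairShift qPair a := rfl

/-- The operators of a coupled function may be pulled out of a linear expression in it. -/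
lemma map_coupledSeq {l m : ℕ} (π : A →+ (Fin l → ℤ) × (Fin m → ℤ)) (s : PairOps l m → A)
    (hs : ∀ p, π (s p) = pairShift p) (Λ : A → Pol₂ →ₗ[K] V) (hΛ : ∀ p a, Λ (a + s p) = Λ a)
    (a : A) : Λ a (coupledSeq (π a).1 (π a).2) =
      applyOps pairSeries s (fun b => Λ b (qPair (π b))) a := by
  have h := applyOps_map π 0 pairSeries s pairShift hs qPair a
  simp only [add_zero] at h
  rw [coupledSeq_eq, ← h]
  let w : (Fin l → ℤ) × (Fin m → ℤ) →+ ℤ := posWeight.coprod posWeight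
  have hw : ∀ b, w b = posWeight b.1 + posWeight b.2 := fun b => rfl
  refine applyOps_linear (w := w.comp π) (fun b hb => ?_) (fun p => ?_) _ Λ (fun p _ => hΛ p) a
  · rw [AddMonoidHom.comp_apply, hw]
    exact add_nonneg (posWeight_nonneg (nonneg_of_prod_rename_q_ne_zero (left_ne_zero_of_mul hb)))
      (posWeight_nonneg (nonneg_of_prod_rename_q_ne_zero (right_ne_zero_of_mul hb)))
  · rw [AddMonoidHom.comp_apply, hs, hw]
    rcases p with p | p | d
    · simpa [pairShift] using posWeight_raise_neg p
    · simpa [pairShift] using posWeight_raise_neg p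
    · exact add_neg (posWeight_neg_unitVec d.1) (posWeight_neg_unitVec d.2)

end HallLittlewood

/-! ### Comparison of all operators on four sequences. -/

section Quadruples

variable {k n m h : ℕ}

/-- All operators on quadruples of sequences: the raising operators of each of the four sequences,
and the operators that lower a position in one of the first two and one of the last two. -/
abbrev QuadOps (k n m h : ℕ) : Type :=
  Pairs k ⊕ Pairs n ⊕ Pairs m ⊕ Pairs h ⊕ ((Fin k ⊕ Fin n) × (Fin m ⊕ Fin h))

/-- A family of series, one for each operator on quadruples. -/
def quadSeries (r₁ r₂ r₃ r₄ : K⟦X⟧) (c : (Fin k ⊕ Fin n) × (Fin m ⊕ Fin h) → K⟦X⟧) :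
    QuadOps k n m h → K⟦X⟧ :=
  Sum.elim (fun _ => r₁) (Sum.elim (fun _ => r₂) (Sum.elim (fun _ => r₃)
    (Sum.elim (fun _ => r₄) c)))

lemma quadSeries_mul (r₁ r₂ r₃ r₄ r₁' r₂' r₃' r₄' : K⟦X⟧)
    (c c' : (Fin k ⊕ Fin n) × (Fin m ⊕ Fin h) → K⟦X⟧) :
    quadSeries r₁ r₂ r₃ r₄ c * quadSeries r₁' r₂' r₃' r₄' c' =
      quadSeries (r₁ * r₁') (r₂ * r₂') (r₃ * r₃') (r₄ * r₄') (c * c') := by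
  funext e
  rcases e with _ | _ | _ | _ | _ <;> rfl

/-- The shift that lowers a position in one of the first two sequences. -/
def lowerLeft : Fin k ⊕ Fin n → Quad k n m h :=
  Sum.elim (fun i => (-unitVec i, 0, 0, 0)) (fun i => (0, -unitVec i, 0, 0))

/-- The shift that lowers a position in one of the last two sequences. -/
def lowerRight : Fin m ⊕ Fin h → Quad k n m h :=
  Sum.elim (fun i => (0, 0, -unitVec i, 0)) (fun i => (0, 0, 0, -unitVec i))

/-- The shifts of all operators on quadruples. -/
def quadShift : QuadOps k n m h → Quad k n m h :=
  Sum.elim (fun p => (raise p, 0, 0, 0)) (Sum.elim (fun p => (0, raise p, 0, 0))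
    (Sum.elim (fun p => (0, 0, raise p, 0)) (Sum.elim (fun p => (0, 0, 0, raise p))
      (fun d => lowerLeft d.1 + lowerRight d.2))))

/-- `q_κ(x) q_ν(x) q_θ(y) q_η(y)`. -/
def qQuad (a : Quad k n m h) : Pol₂ := qPair (a.1, a.2.2.1) * qPair (a.2.1, a.2.2.2)

/-- The weight of a quadruple. -/
def quadWeight : Quad k n m h →+ ℤ :=
  posWeight.coprod (posWeight.coprod (posWeight.coprod posWeight))

lemma quadWeight_apply (a : Quad k n m h) : quadWeight a =
    posWeight a.1 + (posWeight a.2.1 + (posWeight a.2.2.1 + posWeight a.2.2.2)) := rfl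

lemma lowers_quadShift : Lowers quadWeight (quadShift : QuadOps k n m h → _) := by
  have hl : ∀ i, quadWeight (lowerLeft i : Quad k n m h) < 0 := by
    rintro (i | i) <;> simpa [quadWeight_apply, lowerLeft] using posWeight_neg_unitVec i
  have hr : ∀ i, quadWeight (lowerRight i : Quad k n m h) < 0 := by
    rintro (i | i) <;> simpa [quadWeight_apply, lowerRight] using posWeight_neg_unitVec i
  rintro (p | p | p | p | d)
  · simpa [quadWeight_apply, quadShift] using posWeight_raise_neg p
  · simpa [quadWeight_apply, quadShift] using posWeight_raise_neg p
  · simpa [quadWeight_apply, quadShift] using posWeight_raise_neg p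
  · simpa [quadWeight_apply, quadShift] using posWeight_raise_neg p
  · simp only [quadShift, Sum.elim_inr, map_add]
    exact add_neg (hl _) (hr _)

lemma boundedBy_qQuad : BoundedBy quadWeight (qQuad : Quad k n m h → Pol₂) := by
  intro a ha
  have h1 := left_ne_zero_of_mul ha
  have h2 := right_ne_zero_of_mul ha
  have e1 := posWeight_nonneg (nonneg_of_prod_rename_q_ne_zero (left_ne_zero_of_mul h1))
  have e2 := posWeight_nonneg (nonneg_of_prod_rename_q_ne_zero (left_ne_zero_of_mul h2))
  have e3 := posWeight_nonneg (nonneg_of_prod_rename_q_ne_zero (right_ne_zero_of_mul h1))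
  have e4 := posWeight_nonneg (nonneg_of_prod_rename_q_ne_zero (right_ne_zero_of_mul h2))
  rw [quadWeight_apply]
  exact add_nonneg e1 (add_nonneg e2 (add_nonneg e3 e4))

/-- The four-fold product of polynomials in operators, applied to `1`. -/
def mixedProd (p₁ p₂ p₃ p₄ : Pol) : Pol₂ := (substX p₁ * substX p₂ * substY p₃ * substY p₄) 1

/-- The four-fold product of `q`-functions of operators, applied to `1`. -/
def qMixed (a : Quad k n m h) : Pol₂ :=
  mixedProd (∏ i, q (a.1 i)) (∏ i, q (a.2.1 i)) (∏ i, q (a.2.2.1 i)) (∏ i, q (a.2.2.2 i))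

/-- Concatenation of the first two and of the last two sequences. -/
def concat : Quad k n m h →+ (Fin k ⊕ Fin n → ℤ) × (Fin m ⊕ Fin h → ℤ) where
  toFun a := (Sum.elim a.1 a.2.1, Sum.elim a.2.2.1 a.2.2.2)
  map_zero' := by ext i <;> rcases i with i | i <;> rfl
  map_add' a b := by ext i <;> rcases i with i | i <;> rfl

lemma concat_lower (d : (Fin k ⊕ Fin n) × (Fin m ⊕ Fin h)) :
    concat (lowerLeft d.1 + lowerRight d.2) = dShift d := by
  rcases d with ⟨i | i, j | j⟩ <;> ext l <;> rcases l with l | l <;>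
    simp [concat, lowerLeft, lowerRight, dShift, unitVec, Pi.single_apply]

lemma qProd_concat (a : Quad k n m h) : qProd (concat a) = qQuad a := by
  simp only [qProd, concat, AddMonoidHom.coe_mk, ZeroHom.coe_mk, Fintype.prod_sum_type,
    Sum.elim_inl, Sum.elim_inr, qQuad, qPair]
  ring

/-- Applied to 1, the y-type operators give ordinary polynomials in y. Normal ordering for the
concatenated sequences then couples every x-position to every y-position. -/
lemma qMixed_eq (a : Quad k n m h) :
    qMixed a = applyOps (quadSeries 1 1 1 1 fun _ => couplingSeries) quadShift qQuad a := by
  have h1 := substX_prod_q (concat a)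
  have h2 := applyOps_map concat 0 (fun _ => couplingSeries)
    (fun d : (Fin k ⊕ Fin n) × (Fin m ⊕ Fin h) => (lowerLeft d.1 + lowerRight d.2 : Quad k n m h))
    dShift concat_lower qProd a
  simp only [add_zero, qProd_concat] at h2
  rw [applyOps_restrict (fun d => Sum.inr (Sum.inr (Sum.inr (Sum.inr d)))) (fun d d' h => by
    simpa using h) _ _ _ ?_]
  · refine Eq.trans ?_ (h1.trans h2.symm)
    simp only [qMixed, mixedProd, concat, AddMonoidHom.coe_mk, ZeroHom.coe_mk, Fintype.prod_sum_type,
      Sum.elim_inl, Sum.elim_inr]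
    rw [map_mul substX, mul_assoc, ← map_mul substY, Module.End.mul_apply, substY_one, map_mul,
      map_prod (MvPolynomial.rename (R := K) (σ := ℕ+) (τ := ℕ+ ⊕ ℕ+) Sum.inr),
      map_prod (MvPolynomial.rename (R := K) (σ := ℕ+) (τ := ℕ+ ⊕ ℕ+) Sum.inr)]
  · rintro (p | p | p | p | d) hd
    · rfl
    · rfl
    · rfl
    · rfl
    · exact absurd ⟨d, rfl⟩ hd

/-- `mixedProd` as a linear map in argument number 1. -/
def mixedLin₁ (p₂ p₃ p₄ : Pol) : Pol →ₗ[K] Pol₂ where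
  toFun p := mixedProd p p₂ p₃ p₄
  map_add' p p' := by simp [mixedProd, add_mul]
  map_smul' c p := by simp [mixedProd]

/-- `mixedProd` as a linear map in argument number 2. -/
def mixedLin₂ (p₁ p₃ p₄ : Pol) : Pol →ₗ[K] Pol₂ where
  toFun p := mixedProd p₁ p p₃ p₄
  map_add' p p' := by simp [mixedProd, add_mul, mul_add]
  map_smul' c p := by simp [mixedProd]

/-- `mixedProd` as a linear map in argument number 3. -/
def mixedLin₃ (p₁ p₂ p₄ : Pol) : Pol →ₗ[K] Pol₂ where
  toFun p := mixedProd p₁ p₂ p p₄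
  map_add' p p' := by simp [mixedProd, add_mul, mul_add]
  map_smul' c p := by simp [mixedProd]

/-- `mixedProd` as a linear map in argument number 4. -/
def mixedLin₄ (p₁ p₂ p₃ : Pol) : Pol →ₗ[K] Pol₂ where
  toFun p := mixedProd p₁ p₂ p₃ p
  map_add' p p' := by simp [mixedProd, mul_add]
  map_smul' c p := by simp [mixedProd]

/-- The raising operators of one of the four sequences may be pulled out of an expression linear in
its Hall-Littlewood function. -/
lemma map_hlSeq_quad {l : ℕ} (π : Quad k n m h →+ (Fin l → ℤ)) (j : Pairs l → QuadOps k n m h)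
    (hj : Function.Injective j) (φ : QuadOps k n m h → K⟦X⟧) (hφ : ∀ e, e ∉ Set.range j → φ e = 1)
    (hφj : ∀ p, φ (j p) = raisingSeries) (hπ : ∀ p, π (quadShift (j p)) = raise p)
    (Λ : Quad k n m h → Pol →ₗ[K] Pol₂) (hΛ : ∀ p a, Λ (a + quadShift (j p)) = Λ a)
    (a : Quad k n m h) :
    Λ a (hlSeq (π a)) = applyOps φ quadShift (fun b => Λ b (∏ i, q (π b i))) a := by
  rw [applyOps_restrict j hj φ _ _ hφ, funext (f := φ ∘ j) (g := fun _ => raisingSeries) hφj]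
  exact map_hlSeq π _ hπ Λ hΛ a

/-- The expression is linear in each of its four arguments, and the raising operators of one
sequence leave the other three fixed; they are extracted one argument at a time. -/
lemma mixed_eq (a : Quad k n m h) :
    mixed a = applyOps (quadSeries raisingSeries raisingSeries raisingSeries raisingSeries
      fun _ => couplingSeries) quadShift qQuad a := by
  have s₁ (a : Quad k n m h) : mixedProd (hlSeq a.1) (hlSeq a.2.1) (hlSeq a.2.2.1) (hlSeq a.2.2.2) =
      applyOps (quadSeries raisingSeries 1 1 1 1) quadShift
        (fun b => mixedProd (∏ i, q (b.1 i)) (hlSeq b.2.1) (hlSeq b.2.2.1) (hlSeq b.2.2.2)) a :=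
    map_hlSeq_quad (AddMonoidHom.fst _ _) Sum.inl (fun p p' h => by simpa using h) _
      (by rintro (p | p | p | p | d) hd <;> first | exact absurd ⟨_, rfl⟩ hd | rfl)
      (fun _ => rfl) (fun _ => rfl)
      (fun b => mixedLin₁ (hlSeq b.2.1) (hlSeq b.2.2.1) (hlSeq b.2.2.2))
      (fun p b => by simp [quadShift]) a
  have s₂ (a : Quad k n m h) :
      mixedProd (∏ i, q (a.1 i)) (hlSeq a.2.1) (hlSeq a.2.2.1) (hlSeq a.2.2.2) =
      applyOps (quadSeries 1 raisingSeries 1 1 1) quadShift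
        (fun b => mixedProd (∏ i, q (b.1 i)) (∏ i, q (b.2.1 i)) (hlSeq b.2.2.1) (hlSeq b.2.2.2)) a :=
    map_hlSeq_quad ((AddMonoidHom.fst _ _).comp (AddMonoidHom.snd _ _))
      (fun p => Sum.inr (Sum.inl p)) (fun p p' h => by simpa using h) _
      (by rintro (p | p | p | p | d) hd <;> first | exact absurd ⟨_, rfl⟩ hd | rfl)
      (fun _ => rfl) (fun _ => rfl)
      (fun b => mixedLin₂ (∏ i, q (b.1 i)) (hlSeq b.2.2.1) (hlSeq b.2.2.2))
      (fun p b => by simp [quadShift]) a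
  have s₃ (a : Quad k n m h) :
      mixedProd (∏ i, q (a.1 i)) (∏ i, q (a.2.1 i)) (hlSeq a.2.2.1) (hlSeq a.2.2.2) =
      applyOps (quadSeries 1 1 raisingSeries 1 1) quadShift
        (fun b => mixedProd (∏ i, q (b.1 i)) (∏ i, q (b.2.1 i)) (∏ i, q (b.2.2.1 i)) (hlSeq b.2.2.2)) a :=
    map_hlSeq_quad ((AddMonoidHom.fst _ _).comp ((AddMonoidHom.snd _ _).comp (AddMonoidHom.snd _ _)))
      (fun p => Sum.inr (Sum.inr (Sum.inl p))) (fun p p' h => by simpa using h) _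
      (by rintro (p | p | p | p | d) hd <;> first | exact absurd ⟨_, rfl⟩ hd | rfl)
      (fun _ => rfl) (fun _ => rfl)
      (fun b => mixedLin₃ (∏ i, q (b.1 i)) (∏ i, q (b.2.1 i)) (hlSeq b.2.2.2))
      (fun p b => by simp [quadShift]) a
  have s₄ (a : Quad k n m h) :
      mixedProd (∏ i, q (a.1 i)) (∏ i, q (a.2.1 i)) (∏ i, q (a.2.2.1 i)) (hlSeq a.2.2.2) =
      applyOps (quadSeries 1 1 1 raisingSeries 1) quadShift
        (fun b => mixedProd (∏ i, q (b.1 i)) (∏ i, q (b.2.1 i)) (∏ i, q (b.2.2.1 i)) (∏ i, q (b.2.2.2 i))) a :=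
    map_hlSeq_quad ((AddMonoidHom.snd _ _).comp ((AddMonoidHom.snd _ _).comp (AddMonoidHom.snd _ _)))
      (fun p => Sum.inr (Sum.inr (Sum.inr (Sum.inl p)))) (fun p p' h => by simpa using h) _
      (by rintro (p | p | p | p | d) hd <;> first | exact absurd ⟨_, rfl⟩ hd | rfl)
      (fun _ => rfl) (fun _ => rfl)
      (fun b => mixedLin₄ (∏ i, q (b.1 i)) (∏ i, q (b.2.1 i)) (∏ i, q (b.2.2.1 i)))
      (fun p b => by simp [quadShift]) a
  have s₀ : mixed a = mixedProd (hlSeq a.1) (hlSeq a.2.1) (hlSeq a.2.2.1) (hlSeq a.2.2.2) := rfl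
  have hs := lowers_quadShift (k := k) (n := n) (m := m) (h := h)
  have hb := boundedBy_qQuad (k := k) (n := n) (m := m) (h := h)
  have s₅ := qMixed_eq (k := k) (n := n) (m := m) (h := h)
  unfold qMixed at s₅
  rw [s₀, s₁, funext s₂, funext s₃, funext s₄, funext s₅, funext (applyOps_mul hb hs _ _),
    funext (applyOps_mul hb hs _ _), funext (applyOps_mul hb hs _ _), applyOps_mul hb hs]
  simp only [quadSeries_mul, one_mul, mul_one]

lemma coupledSeq_mul_coupledSeq (a : Quad k n m h) :
    coupledSeq a.1 a.2.2.1 * coupledSeq a.2.1 a.2.2.2 =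
      applyOps (quadSeries raisingSeries raisingSeries raisingSeries raisingSeries
        fun d => if d.1.isLeft = d.2.isLeft then couplingSeries else 1) quadShift qQuad a := by
  let j₁ : PairOps k m → QuadOps k n m h := Sum.elim Sum.inl
    (Sum.elim (fun p => Sum.inr (Sum.inr (Sum.inl p)))
      (fun d => Sum.inr (Sum.inr (Sum.inr (Sum.inr (Sum.inl d.1, Sum.inl d.2))))))
  let j₂ : PairOps n h → QuadOps k n m h := Sum.elim (fun p => Sum.inr (Sum.inl p))
    (Sum.elim (fun p => Sum.inr (Sum.inr (Sum.inr (Sum.inl p))))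
      (fun d => Sum.inr (Sum.inr (Sum.inr (Sum.inr (Sum.inr d.1, Sum.inr d.2))))))
  have hj₁ : Function.Injective j₁ := by
    rintro (p | p | d) (p' | p' | d') h <;> simp [j₁, Prod.ext_iff] at h ⊢ <;> exact h
  have hj₂ : Function.Injective j₂ := by
    rintro (p | p | d) (p' | p' | d') h <;> simp [j₂, Prod.ext_iff] at h ⊢ <;> exact h
  have s₁ (a : Quad k n m h) : coupledSeq a.1 a.2.2.1 * coupledSeq a.2.1 a.2.2.2 =
      applyOps (quadSeries raisingSeries 1 raisingSeries 1
        fun d => if d.1.isLeft ∧ d.2.isLeft then couplingSeries else 1) quadShift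
        (fun b => qPair (b.1, b.2.2.1) * coupledSeq b.2.1 b.2.2.2) a := by
    rw [applyOps_restrict j₁ hj₁ _ _ _ (by
      rintro (p | p | p | p | ⟨i | i, j | j⟩) hd
      · exact absurd ⟨Sum.inl p, rfl⟩ hd
      · rfl
      · exact absurd ⟨Sum.inr (Sum.inl p), rfl⟩ hd
      · rfl
      · exact absurd ⟨Sum.inr (Sum.inr (i, j)), rfl⟩ hd
      all_goals simp [quadSeries])]
    have hφ : quadSeries raisingSeries 1 raisingSeries 1
        (fun d => if d.1.isLeft ∧ d.2.isLeft then couplingSeries else 1) ∘ j₁ = pairSeries := by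
      funext e
      rcases e with p | p | d <;> simp [j₁, quadSeries, pairSeries]
    rw [hφ]
    have hm := map_coupledSeq (A := Quad k n m h) (V := Pol₂)
      ((AddMonoidHom.fst _ _).prod
      ((AddMonoidHom.fst _ _).comp ((AddMonoidHom.snd _ _).comp (AddMonoidHom.snd _ _))))
      (quadShift ∘ j₁)
      (by rintro (p | p | d) <;> simp [j₁, quadShift, pairShift, lowerLeft, lowerRight])
      (fun b => LinearMap.mulRight K (coupledSeq b.2.1 b.2.2.2))
      (by rintro (p | p | d) b <;> simp [j₁, quadShift, lowerLeft, lowerRight]) a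
    simp only [LinearMap.mulRight_apply] at hm
    exact hm
  have s₂ (a : Quad k n m h) : qPair (a.1, a.2.2.1) * coupledSeq a.2.1 a.2.2.2 =
      applyOps (quadSeries 1 raisingSeries 1 raisingSeries
        fun d => if d.1.isRight ∧ d.2.isRight then couplingSeries else 1) quadShift qQuad a := by
    rw [applyOps_restrict j₂ hj₂ _ _ _ (by
      rintro (p | p | p | p | ⟨i | i, j | j⟩) hd
      · rfl
      · exact absurd ⟨Sum.inl p, rfl⟩ hd
      · rfl
      · exact absurd ⟨Sum.inr (Sum.inl p), rfl⟩ hd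
      · simp [quadSeries]
      · simp [quadSeries]
      · simp [quadSeries]
      · exact absurd ⟨Sum.inr (Sum.inr (i, j)), rfl⟩ hd)]
    have hφ : quadSeries 1 raisingSeries 1 raisingSeries
        (fun d => if d.1.isRight ∧ d.2.isRight then couplingSeries else 1) ∘ j₂ = pairSeries := by
      funext e
      rcases e with p | p | d <;> simp [j₂, quadSeries, pairSeries]
    rw [hφ]
    have hm := map_coupledSeq (A := Quad k n m h) (V := Pol₂)
      (((AddMonoidHom.fst _ _).comp (AddMonoidHom.snd _ _)).prod
      ((AddMonoidHom.snd _ _).comp ((AddMonoidHom.snd _ _).comp (AddMonoidHom.snd _ _))))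
      (quadShift ∘ j₂)
      (by rintro (p | p | d) <;> simp [j₂, quadShift, pairShift, lowerLeft, lowerRight])
      (fun b => LinearMap.mulLeft K (qPair (b.1, b.2.2.1)))
      (by rintro (p | p | d) b <;> simp [j₂, quadShift, lowerLeft, lowerRight]) a
    simp only [LinearMap.mulLeft_apply] at hm
    exact hm
  rw [s₁, funext s₂, applyOps_mul boundedBy_qQuad lowers_quadShift, quadSeries_mul]
  simp only [one_mul, mul_one]
  congr 2
  funext d
  rcases d with ⟨i | i, j | j⟩ <;> simp

lemma crossOps_mixed (a : Quad k n m h) :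
    crossOps mixed a = coupledSeq a.1 a.2.2.1 * coupledSeq a.2.1 a.2.2.2 := by
  have hj : crossOps mixed a = applyOps (quadSeries 1 1 1 1
      fun d => if d.1.isLeft = d.2.isLeft then 1 else decouplingSeries) quadShift mixed a := by
    -- An operator for (θ, ν) is indexed with the y-position first, while `QuadOps` puts the
    -- x-position first; hence the swap in the second branch.
    rw [applyOps_restrict (Sum.elim
      (fun d : Fin k × Fin h => Sum.inr (Sum.inr (Sum.inr (Sum.inr (Sum.inl d.1, Sum.inr d.2)))))
      (fun d : Fin m × Fin n => Sum.inr (Sum.inr (Sum.inr (Sum.inr (Sum.inr d.2, Sum.inl d.1))))))]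
    · rw [crossOps]
      congr 1
      · funext d
        rcases d with d | d <;> rfl
      · funext d
        rcases d with d | d <;> simp [crossShift, quadShift, lowerLeft, lowerRight]
    · rintro (d | d) (d' | d') h <;> simp [Prod.ext_iff] at h ⊢ <;> tauto
    · rintro (p | p | p | p | ⟨i | i, j | j⟩) hd
      · rfl
      · rfl
      · rfl
      · rfl
      · rfl
      · exact absurd ⟨Sum.inl (i, j), rfl⟩ hd
      · exact absurd ⟨Sum.inr (j, i), rfl⟩ hd
      · rfl
  rw [hj, applyOps_congr mixed_eq, applyOps_mul boundedBy_qQuad lowers_quadShift, quadSeries_mul,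
    coupledSeq_mul_coupledSeq]
  simp only [one_mul]
  congr 2
  funext d
  simp only [Pi.mul_apply]
  split_ifs
  · rw [one_mul]
  · rw [coupling_mul_decoupling]

lemma finite_crossShift (a : Quad k n m h) :
    {f : (Fin k × Fin h) ⊕ (Fin m × Fin n) → ℕ |
      mixed (a + ∑ e, f e • crossShift e) ≠ 0}.Finite := by
  have hb : BoundedBy quadWeight (mixed : Quad k n m h → Pol₂) := by
    rw [funext mixed_eq]
    exact boundedBy_qQuad.applyOps lowers_quadShift _
  refine hb.finite ?_ a
  rintro (d | d)
  · have h1 := posWeight_neg_unitVec d.1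
    have h2 := posWeight_neg_unitVec d.2
    simp only [quadWeight_apply, crossShift, Sum.elim_inl, map_zero]
    omega
  · have h1 := posWeight_neg_unitVec d.1
    have h2 := posWeight_neg_unitVec d.2
    simp only [quadWeight_apply, crossShift, Sum.elim_inr, map_zero]
    omega

lemma hlSeq_fin_zero (α : Fin 0 → ℤ) : hlSeq α = 1 := by
  rw [hlSeq, applyOps_restrict (ι' := Empty) Empty.elim (fun e => e.elim) _ _ _
    fun p => p.1.1.elim0, applyOps, finsum_unique]
  simp

/-- The case of `mixed_eq` with second and fourth sequences empty: the remaining operators are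
exactly those defining the coupled function. -/
lemma substX_hlSeq_substY_hlSeq {l m : ℕ} (α : Fin l → ℤ) (β : Fin m → ℤ) :
    (substX (hlSeq α) * substY (hlSeq β)) 1 = coupledSeq α β := by
  let g : (Fin l → ℤ) × (Fin m → ℤ) →+ Quad l 0 m 0 :=
    (AddMonoidHom.fst _ _).prod ((0 : _ →+ (Fin 0 → ℤ)).prod
      ((AddMonoidHom.snd _ _).prod (0 : _ →+ (Fin 0 → ℤ))))
  have hg : ∀ b, g b = (b.1, 0, b.2, 0) := fun b => rfl
  have h1 : mixed (g (α, β)) = (substX (hlSeq α) * substY (hlSeq β)) 1 := by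
    rw [mixed, hg, hlSeq_fin_zero, map_one substX, map_one substY, mul_one, mul_one]
  let j : PairOps l m → QuadOps l 0 m 0 := Sum.elim Sum.inl
    (Sum.elim (fun p => Sum.inr (Sum.inr (Sum.inl p)))
      (fun d => Sum.inr (Sum.inr (Sum.inr (Sum.inr (Sum.inl d.1, Sum.inl d.2))))))
  have hj : Function.Injective j := by
    rintro (p | p | d) (p' | p' | d') h <;> simp [j, Prod.ext_iff] at h ⊢ <;> exact h
  rw [← h1, mixed_eq, applyOps_restrict j hj]
  · have hφ : quadSeries raisingSeries raisingSeries raisingSeries raisingSeries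
        (fun _ => couplingSeries) ∘ j = pairSeries := by
      funext e
      rcases e with p | p | d <;> rfl
    have hmap := applyOps_map g 0 pairSeries pairShift (quadShift ∘ j) (by
      rintro (p | p | d) <;> simp [j, hg, quadShift, pairShift, lowerLeft, lowerRight])
      qQuad (α, β)
    simp only [add_zero] at hmap
    rw [hφ, ← hmap]
    refine (applyOps_congr (fun b => ?_) _).trans (coupledSeq_eq (α, β)).symm
    simp [qQuad, hg, qPair]
  · rintro (p | p | p | p | ⟨i | i, i' | i'⟩) hd
    · exact absurd ⟨Sum.inl p, rfl⟩ hd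
    · exact p.1.1.elim0
    · exact absurd ⟨Sum.inr (Sum.inl p), rfl⟩ hd
    · exact p.1.1.elim0
    · exact absurd ⟨Sum.inr (Sum.inr (i, i')), rfl⟩ hd
    · exact i'.elim0
    · exact i.elim0
    · exact i.elim0

end Quadruples

/-! ### The q_n with n ≥ 1 as free polynomial generators. -/

section QBasis

/-- The substitution `x_n ↦ q_n`. -/
def toQ : Pol →ₐ[K] Pol := MvPolynomial.aeval fun n : ℕ+ => q (n : ℕ)

lemma toQ_X (j : ℕ) : toQ (xVar j) = q (j + 1 : ℕ) := by
  rw [toQ, MvPolynomial.aeval_X, Nat.succPNat_coe]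

lemma newton_coeff_ne_zero (n : ℕ) : ((n : K) + 1) * (1 - t ^ (n + 1)) ≠ 0 :=
  mul_ne_zero (natCast_succ_ne_zero n) (sub_ne_zero.2 (t_pow_ne_one n.succ_ne_zero).symm)

/-- Isolates the term with q_0 = 1. Its coefficient is nonzero because t is not a root of unity, so
the recursion can be solved for x_{n+1} or for q_{n+1}. -/
lemma newton_leading (n : ℕ) : ((n : K) + 1) • q (n + 1 : ℕ) =
    (((n : K) + 1) * (1 - t ^ (n + 1))) • xVar n + ∑ j : Fin n,
      (((j : ℕ) + 1 : K) * (1 - t ^ ((j : ℕ) + 1))) •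
        (xVar j * q ((n - 1 - (j : ℕ)) + 1 : ℕ)) := by
  rw [newton, Finset.Nat.sum_antidiagonal_eq_sum_range_succ_mk, ← Finset.sum_range_reflect,
    Finset.sum_range_succ, add_comm]
  congr 1
  · simp [q_zero]
  · rw [Finset.sum_range]
    refine Finset.sum_congr rfl fun j _ => ?_
    have h1 : n + 1 - 1 - (j : ℕ) = n - 1 - (j : ℕ) + 1 := by have := j.2; omega
    have h2 : n - (n - 1 - (j : ℕ) + 1) = j := by have := j.2; omega
    simp only [h1, h2]

/-- The expression of `x_{n+1}` as a polynomial in the `q_j`. -/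
def xInQ (n : ℕ) : Pol :=
  (((n : K) + 1) * (1 - t ^ (n + 1)))⁻¹ • (((n : K) + 1) • xVar n - ∑ j : Fin n,
    (((j : ℕ) + 1 : K) * (1 - t ^ ((j : ℕ) + 1))) • (xInQ j * xVar (n - 1 - (j : ℕ))))
termination_by n
decreasing_by exact j.2

/-- The substitution inverse to `toQ`. -/
def ofQ : Pol →ₐ[K] Pol := MvPolynomial.aeval fun n : ℕ+ => xInQ n.natPred

lemma ofQ_X (j : ℕ) : ofQ (xVar j) = xInQ j := by
  rw [ofQ, MvPolynomial.aeval_X, Nat.natPred_succPNat]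

lemma ofQ_q (n : ℕ) : ofQ (q (n + 1 : ℕ)) = xVar n := by
  induction n using Nat.strong_induction_on with
  | _ n ih =>
    have h := congrArg ofQ (newton_leading n)
    rw [map_smul, map_add, map_smul, map_sum, ofQ_X, xInQ,
      smul_inv_smul₀ (newton_coeff_ne_zero n)] at h
    have h2 : ∀ j : Fin n, ofQ ((((j : ℕ) + 1 : K) * (1 - t ^ ((j : ℕ) + 1))) •
        (xVar j * q ((n - 1 - (j : ℕ)) + 1 : ℕ))) =
        (((j : ℕ) + 1 : K) * (1 - t ^ ((j : ℕ) + 1))) • (xInQ j * xVar (n - 1 - (j : ℕ))) := by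
      intro j
      rw [map_smul, map_mul, ofQ_X, ih _ (by have := j.2; omega)]
    rw [Finset.sum_congr rfl fun j _ => h2 j, sub_add_cancel] at h
    exact smul_right_injective _ (natCast_succ_ne_zero n) h

lemma toQ_injective : Function.Injective toQ := by
  have : ofQ.comp toQ = AlgHom.id K Pol := by
    refine MvPolynomial.algHom_ext fun n => ?_
    obtain ⟨j, rfl⟩ : ∃ j : ℕ, n = j.succPNat := ⟨n.natPred, (PNat.succPNat_natPred n).symm⟩
    exact (congrArg ofQ (toQ_X j)).trans (ofQ_q j)
  exact Function.LeftInverse.injective (g := ofQ) fun p => DFunLike.congr_fun this p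

/-- By strong induction, `newton_leading` expresses each variable through q's and earlier variables.
-/
lemma toQ_surjective : Function.Surjective toQ := by
  have hX : ∀ n, xVar n ∈ toQ.range := by
    intro n
    induction n using Nat.strong_induction_on with
    | _ n ih =>
      have hq : ∀ j : ℕ, q (j + 1 : ℕ) ∈ toQ.range := fun j => ⟨xVar j, toQ_X j⟩
      have h : xVar n = (((n : K) + 1) * (1 - t ^ (n + 1)))⁻¹ • (((n : K) + 1) • q (n + 1 : ℕ) -
          ∑ j : Fin n, (((j : ℕ) + 1 : K) * (1 - t ^ ((j : ℕ) + 1))) •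
            (xVar j * q ((n - 1 - (j : ℕ)) + 1 : ℕ))) := by
        rw [newton_leading, add_sub_cancel_right, inv_smul_smul₀ (newton_coeff_ne_zero n)]
      have hsum : ∑ j : Fin n, (((j : ℕ) + 1 : K) * (1 - t ^ ((j : ℕ) + 1))) •
          (xVar j * q ((n - 1 - (j : ℕ)) + 1 : ℕ)) ∈ toQ.range :=
        sum_mem fun j _ => Subalgebra.smul_mem _ (mul_mem (ih _ j.isLt) (hq _)) _
      have hlead := Subalgebra.smul_mem toQ.range (hq n) ((n : K) + 1)
      exact h ▸ Subalgebra.smul_mem _ (sub_mem hlead hsum) _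
  intro p
  induction p using MvPolynomial.induction_on with
  | C c => exact ⟨MvPolynomial.C c, by simp [toQ]⟩
  | add p p' h h' =>
    obtain ⟨a, rfl⟩ := h
    obtain ⟨b, rfl⟩ := h'
    exact ⟨a + b, map_add _ _ _⟩
  | mul_X p n h =>
    obtain ⟨a, rfl⟩ := h
    obtain ⟨b, hb⟩ := hX n.natPred
    refine ⟨a * b, ?_⟩
    rw [map_mul]
    congr 1
    rw [← PNat.succPNat_natPred n]
    exact hb

end QBasis

/-! ### Young diagrams as exponent vectors. -/

section Exponents

/-- The exponent vector of `x_n`, and zero for `n = 0`. -/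
def varExp : ℕ → ℕ+ →₀ ℕ
  | 0 => 0
  | n + 1 => Finsupp.single n.succPNat 1

/-- The sum of the parts of a partition given by multiplicities. -/
def size : (ℕ+ →₀ ℕ) →+ ℤ := Finsupp.weight fun n : ℕ+ => ((n : ℕ) : ℤ)

/-- The sum of the squares of the parts of a partition given by multiplicities. -/
def sqNorm : (ℕ+ →₀ ℕ) →+ ℤ := Finsupp.weight fun n : ℕ+ => ((n : ℕ) : ℤ) ^ 2

lemma size_varExp (n : ℕ) : size (varExp n) = n := by
  cases n with
  | zero => simp [varExp]
  | succ n => simp [varExp, size, Finsupp.weight_single]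

lemma sqNorm_varExp (n : ℕ) : sqNorm (varExp n) = (n : ℤ) ^ 2 := by
  cases n with
  | zero => simp [varExp]
  | succ n => simp [varExp, sqNorm, Finsupp.weight_single]

/-- The cross terms in the square of a sum of nonnegative parts are nonnegative. The bound makes the
induction in `toQ_monomial_mem_span` terminate. -/
lemma size_nonneg_and_sqNorm_le (m : ℕ+ →₀ ℕ) : 0 ≤ size m ∧ sqNorm m ≤ size m ^ 2 := by
  induction m using Finsupp.induction_linear with
  | zero => simp
  | add a b ha hb =>
    rw [map_add, map_add]
    exact ⟨add_nonneg ha.1 hb.1, by nlinarith [mul_nonneg ha.1 hb.1]⟩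
  | single n c =>
    have h1 : size (Finsupp.single n c) = c * (n : ℕ) := by simp [size, Finsupp.weight_apply]
    have h2 : sqNorm (Finsupp.single n c) = c * ((n : ℕ) : ℤ) ^ 2 := by
      simp [sqNorm, Finsupp.weight_apply]
    rw [h1, h2, mul_pow]
    refine ⟨by positivity, mul_le_mul_of_nonneg_right ?_ (by positivity)⟩
    exact_mod_cast Nat.le_self_pow two_ne_zero c

lemma q_eq_toQ (n : ℕ) : q n = toQ (MvPolynomial.monomial (varExp n) 1) := by
  cases n with
  | zero => simpa [varExp] using q_zero
  | succ j => exact (toQ_X j).symm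

lemma prod_q_eq_toQ {l : ℕ} (β : Fin l → ℕ) :
    ∏ i, q (β i) = toQ (MvPolynomial.monomial (∑ i, varExp (β i)) 1) := by
  rw [MvPolynomial.monomial_sum_one, map_prod]
  exact Finset.prod_congr rfl fun i _ => q_eq_toQ _

/-- The multiplicities of the parts of a Young diagram. -/
def expVec (lam : YoungDiagram) : ℕ+ →₀ ℕ := ∑ i : Fin (lam.colLen 0), varExp (lam.rowLen i)

lemma sum_varExp_apply (L : List ℕ) (n : ℕ+) : (L.map varExp).sum n = L.count (n : ℕ) := by
  induction L with
  | nil => simp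
  | cons a L ih =>
    rw [List.map_cons, List.sum_cons, Finsupp.add_apply, ih, List.count_cons, add_comm]
    congr 1
    cases a with
    | zero =>
      have : ¬ (0 = (n : ℕ)) := n.pos.ne
      simp [varExp, this]
    | succ a =>
      rw [varExp, Finsupp.single_apply]
      congr 1
      rw [beq_iff_eq, ← PNat.coe_inj, Nat.succPNat_coe]

lemma expVec_apply (lam : YoungDiagram) (n : ℕ+) : expVec lam n = lam.rowLens.count (n : ℕ) := by
  rw [← sum_varExp_apply, expVec, YoungDiagram.rowLens, List.map_map, ← Finset.sum_range
    (fun i => varExp (lam.rowLen i))]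
  rfl

/-- Equal multiplicities make the two lists of row lengths permutations of each other, and both are
sorted. -/
lemma expVec_injective : Function.Injective expVec := by
  intro lam mu h
  have hp : lam.rowLens.Perm mu.rowLens := by
    rw [List.perm_iff_count]
    intro n
    rcases n with _ | n
    · rw [List.count_eq_zero.2 fun h0 => (lam.pos_of_mem_rowLens 0 h0).false,
        List.count_eq_zero.2 fun h0 => (mu.pos_of_mem_rowLens 0 h0).false]
    · rw [← Nat.succ_eq_add_one, ← Nat.succPNat_coe, ← expVec_apply, ← expVec_apply, h]
  have he : lam.rowLens = mu.rowLens :=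
    hp.eq_of_sortedGE lam.rowLens_sorted mu.rowLens_sorted
  exact YoungDiagram.equivListRowLens.injective (Subtype.ext he)

lemma expVec_surjective : Function.Surjective expVec := by
  intro m
  let s : Multiset ℕ := (Finsupp.toMultiset m).map PNat.val
  have hpos : ∀ x ∈ s.sort (· ≥ ·), 0 < x := by
    intro x hx
    rw [Multiset.mem_sort, Multiset.mem_map] at hx
    obtain ⟨n, _, rfl⟩ := hx
    exact n.pos
  have hsort : (s.sort (· ≥ ·)).SortedGE := (Multiset.pairwise_sort s (· ≥ ·)).sortedGE
  refine ⟨YoungDiagram.ofRowLens _ hsort, ?_⟩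
  ext n
  rw [expVec_apply, YoungDiagram.rowLens_ofRowLens_eq_self hpos, ← Multiset.coe_count,
    Multiset.sort_eq, Multiset.count_map_eq_count' _ _ PNat.coe_injective,
    Finsupp.count_toMultiset]

end Exponents

/-! ### The Hall–Littlewood functions form a basis. -/

section Triangularity

lemma coeff_zero_raisingSeries : PowerSeries.coeff 0 raisingSeries = 1 := by
  simp [raisingSeries]

/-- Raising operators increase the sum of squares of a weakly decreasing sequence. -/
lemma sum_sq_lt_of_raise {l : ℕ} {α : Fin l → ℤ} (hα : Antitone α) {c : Pairs l → ℕ} (hc : c ≠ 0) :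
    ∑ i, α i ^ 2 < ∑ i, (α + ∑ p, c p • raise p) i ^ 2 := by
  set ρ : Fin l → ℤ := ∑ p, c p • raise p with hρ
  -- A zero total shift would leave `posWeight` unchanged, although every raising lowers it.
  have hne : ρ ≠ 0 := by
    intro h0
    have h1 := Lowers.weight_add_sum_le (w := posWeight) (s := raise (l := l))
      posWeight_raise_neg 0 c
    rw [← hρ, h0, add_zero, map_zero, zero_add] at h1
    refine hc (funext fun p => ?_)
    have h2 : (c p : ℤ) ≤ ∑ p, (c p : ℤ) :=
      Finset.single_le_sum (f := fun p => (c p : ℤ)) (fun _ _ => Int.natCast_nonneg _)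
        (Finset.mem_univ p)
    simp only [Pi.zero_apply]
    omega
  have hpos : 0 < ∑ i, ρ i ^ 2 := by
    obtain ⟨i, hi⟩ := Function.ne_iff.1 hne
    exact Finset.sum_pos' (fun _ _ => sq_nonneg _)
      ⟨i, Finset.mem_univ i, sq_pos_of_ne_zero hi⟩
  -- Pairing α with the shift of R_{ij} gives α_i - α_j, which is nonnegative for i < j since α
  -- decreases weakly.
  have hdot : 0 ≤ ∑ i, α i * ρ i := by
    have : ∑ i, α i * ρ i = ∑ p, (c p : ℤ) * (α p.1.1 - α p.1.2) := by
      simp only [hρ, Finset.sum_apply, Finset.mul_sum]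
      rw [Finset.sum_comm]
      refine Finset.sum_congr rfl fun p _ => ?_
      simp only [Pi.smul_apply, raise, unitVec, Pi.sub_apply, nsmul_eq_mul, mul_left_comm (α _)]
      rw [← Finset.mul_sum]
      simp [mul_sub, Pi.single_apply]
    rw [this]
    exact Finset.sum_nonneg fun p _ =>
      mul_nonneg (Int.natCast_nonneg _) (sub_nonneg.2 (hα p.2.le))
  have hexp : ∑ i, (α + ρ) i ^ 2 = ∑ i, α i ^ 2 + 2 * ∑ i, α i * ρ i + ∑ i, ρ i ^ 2 := by
    rw [Finset.mul_sum, ← Finset.sum_add_distrib, ← Finset.sum_add_distrib]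
    exact Finset.sum_congr rfl fun i _ => by rw [Pi.add_apply]; ring
  linarith

lemma sum_raise {l : ℕ} (α : Fin l → ℤ) (c : Pairs l → ℕ) :
    ∑ i, (α + ∑ p, c p • raise p) i = ∑ i, α i := by
  simp only [Pi.add_apply, Finset.sum_add_distrib, Finset.sum_apply, Pi.smul_apply]
  rw [Finset.sum_comm, add_eq_left]
  refine Finset.sum_eq_zero fun p _ => ?_
  rw [← Finset.smul_sum]
  simp [raise, unitVec]

/-- The `q`-expansions all of whose terms have the given size and a larger sum of squares. -/
def higherTerms (m : ℕ+ →₀ ℕ) : Submodule K Pol :=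
  MvPolynomial.restrictSupport K {m' | size m' = size m ∧ sqNorm m < sqNorm m'}

/-- `Q_λ` is `q_λ` plus terms whose parts have a larger sum of squares. -/
lemma exists_higherTerms (lam : YoungDiagram) : ∃ r ∈ higherTerms (expVec lam),
    Q lam = toQ (MvPolynomial.monomial (expVec lam) 1 + r) := by
  classical
  have hanti : Antitone (parts lam) := fun i j hij => by
    simpa [parts] using lam.rowLen_anti i j hij
  have hfin := boundedBy_prod_q.finite (s := raise) posWeight_raise_neg (parts lam)
  -- Inserting 0 allows the leading term to be split off without showing that it is nonzero.
  let T := insert 0 hfin.toFinset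
  have hQ : Q lam = ∑ c ∈ T, (∏ p, PowerSeries.coeff (c p) raisingSeries) •
      ∏ i, q ((parts lam + ∑ p, c p • raise p) i) := by
    refine finsum_eq_sum_of_support_subset _ fun c hc => ?_
    refine Finset.mem_coe.2 (Finset.mem_insert_of_mem (hfin.mem_toFinset.2 ?_))
    exact right_ne_zero_of_smul hc
  have hsize : size (expVec lam) = ∑ i, parts lam i := by
    simp [expVec, map_sum, size_varExp, parts]
  have hsq : sqNorm (expVec lam) = ∑ i, parts lam i ^ 2 := by
    simp [expVec, map_sum, sqNorm_varExp, parts]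
  have hterm : ∀ c : Pairs (lam.colLen 0) → ℕ, c ≠ 0 → ∃ r ∈ higherTerms (expVec lam),
      ∏ i, q ((parts lam + ∑ p, c p • raise p) i) = toQ r := by
    intro c hc
    by_cases hneg : ∃ i, (parts lam + ∑ p, c p • raise p) i < 0
    · obtain ⟨i, hi⟩ := hneg
      exact ⟨0, Submodule.zero_mem _, by
        rw [Finset.prod_eq_zero (Finset.mem_univ i) (q_neg hi), map_zero]⟩
    · push Not at hneg
      have h1 := sum_sq_lt_of_raise hanti hc
      have h2 := sum_raise (parts lam) c
      generalize parts lam + ∑ p, c p • raise p = β at *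
      lift β to Fin (lam.colLen 0) → ℕ using hneg
      refine ⟨_, ?_, prod_q_eq_toQ β⟩
      rw [higherTerms, MvPolynomial.monomial_mem_restrictSupport]
      left
      simp only [Set.mem_ofPred_eq, hsize, hsq, map_sum, size_varExp, sqNorm_varExp]
      exact ⟨h2, h1⟩
  choose! r hr hrq using hterm
  refine ⟨∑ c ∈ T.erase 0, (∏ p, PowerSeries.coeff (c p) raisingSeries) • r c,
    Submodule.sum_mem _ fun c hc => Submodule.smul_mem _ _ (hr c (Finset.ne_of_mem_erase hc)), ?_⟩
  rw [hQ, ← Finset.add_sum_erase T _ (Finset.mem_insert_self _ _), map_add, map_sum]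
  congr 1
  · have h0 : ∏ i, q (parts lam i) = toQ (MvPolynomial.monomial (expVec lam) 1) :=
      prod_q_eq_toQ fun i : Fin (lam.colLen 0) => lam.rowLen i
    simp [coeff_zero_raisingSeries, h0]
  · refine Finset.sum_congr rfl fun c hc => ?_
    rw [hrq c (Finset.ne_of_mem_erase hc), map_smul]

/-- In a vanishing combination, take λ in the support with least sum of squares. Every correction
term met has a strictly larger sum, so the coefficient of q_λ is that of Q_λ alone. -/
lemma linearIndependent_Q : LinearIndependent K Q := by
  classical
  choose r hr hQ using exists_higherTerms
  rw [linearIndependent_iff]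
  intro f hf
  by_contra hne
  obtain ⟨lam, hlam, hmin⟩ := Finset.exists_min_image f.support (fun lam => sqNorm (expVec lam))
    (Finsupp.support_nonempty_iff.2 hne)
  have h0 : ∑ mu ∈ f.support, f mu • (MvPolynomial.monomial (expVec mu) 1 + r mu) = 0 := by
    apply toQ_injective
    rw [map_sum, map_zero, ← hf, Finsupp.linearCombination_apply, Finsupp.sum]
    exact Finset.sum_congr rfl fun mu _ => by rw [map_smul, ← hQ]
  have h1 := congrArg (MvPolynomial.coeff (expVec lam)) h0
  rw [MvPolynomial.coeff_sum, MvPolynomial.coeff_zero, Finset.sum_eq_single lam] at h1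
  · have h2 : MvPolynomial.coeff (expVec lam) (r lam) = 0 := by
      by_contra h
      exact lt_irrefl _ (((MvPolynomial.mem_restrictSupport_iff K).1 (hr lam))
        (MvPolynomial.mem_support_iff.2 h)).2
    rw [MvPolynomial.coeff_smul, MvPolynomial.coeff_add, h2, MvPolynomial.coeff_monomial,
      if_pos rfl, add_zero, smul_eq_mul, mul_one] at h1
    exact Finsupp.mem_support_iff.1 hlam h1
  · intro mu hmu hmulam
    have h2 : MvPolynomial.coeff (expVec lam) (r mu) = 0 := by
      by_contra h
      exact (hmin mu hmu).not_gt (((MvPolynomial.mem_restrictSupport_iff K).1 (hr mu))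
        (MvPolynomial.mem_support_iff.2 h)).2
    rw [MvPolynomial.coeff_smul, MvPolynomial.coeff_add, h2, MvPolynomial.coeff_monomial,
      if_neg fun h => hmulam (expVec_injective h), add_zero, smul_zero]
  · exact fun h => absurd hlam h

/-- Replacing q_λ by Q_λ leaves terms of the same size and larger sum of squares, so size² minus the
sum of squares, a nonnegative integer, decreases. -/
lemma toQ_monomial_mem_span (m : ℕ+ →₀ ℕ) :
    toQ (MvPolynomial.monomial m 1) ∈ Submodule.span K (Set.range Q) := by
  induction hd : (size m ^ 2 - sqNorm m).toNat using Nat.strong_induction_on generalizing m with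
  | _ d ih =>
    obtain ⟨lam, rfl⟩ := expVec_surjective m
    obtain ⟨r, hr, hQ⟩ := exists_higherTerms lam
    have h1 : toQ (MvPolynomial.monomial (expVec lam) 1) = Q lam - toQ r := by
      rw [hQ, map_add, add_sub_cancel_right]
    rw [h1]
    refine Submodule.sub_mem _ (Submodule.subset_span ⟨lam, rfl⟩) ?_
    rw [MvPolynomial.as_sum r, map_sum]
    refine Submodule.sum_mem _ fun m' hm' => ?_
    have h2 : MvPolynomial.monomial m' (MvPolynomial.coeff m' r) =
        MvPolynomial.coeff m' r • MvPolynomial.monomial m' (1 : K) := by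
      rw [MvPolynomial.smul_monomial, smul_eq_mul, mul_one]
    rw [h2, map_smul]
    refine Submodule.smul_mem _ _ (ih _ ?_ m' rfl)
    obtain ⟨h3, h4⟩ := ((MvPolynomial.mem_restrictSupport_iff K).1 hr) hm'
    have h5 := (size_nonneg_and_sqNorm_le m').2
    rw [← hd, h3]
    rw [h3] at h5
    omega

lemma span_Q : Submodule.span K (Set.range Q) = ⊤ := by
  rw [eq_top_iff]
  rintro p -
  obtain ⟨p, rfl⟩ := toQ_surjective p
  rw [MvPolynomial.as_sum p, map_sum]
  refine Submodule.sum_mem _ fun m _ => ?_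
  have h : MvPolynomial.monomial m (MvPolynomial.coeff m p) =
      MvPolynomial.coeff m p • MvPolynomial.monomial m (1 : K) := by
    rw [MvPolynomial.smul_monomial, smul_eq_mul, mul_one]
  rw [h, map_smul]
  exact Submodule.smul_mem _ _ (toQ_monomial_mem_span m)

lemma linearCombination_structureConst (kap nu : YoungDiagram) :
    Finsupp.linearCombination K Q (structureConst kap nu) = Q kap * Q nu := by
  have h : ∃ f : YoungDiagram →₀ K, Finsupp.linearCombination K Q f = Q kap * Q nu := by
    have := (Submodule.mem_top : Q kap * Q nu ∈ (⊤ : Submodule K Pol))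
    rw [← span_Q, Finsupp.mem_span_range_iff_exists_finsupp] at this
    exact this
  exact Classical.epsilon_spec h

lemma linearCombination_eq_iff (kap nu : YoungDiagram) (f : YoungDiagram →₀ K) :
    Finsupp.linearCombination K Q f = Q kap * Q nu ↔ f = structureConst kap nu := by
  rw [← linearCombination_structureConst]
  exact linearIndependent_Q.eq_iff

end Triangularity

/-! ### The two formulas for Young diagrams. -/

lemma coupledQ_mul_coupledQ (kap the nu eta : YoungDiagram) :
    coupledQ kap the * coupledQ nu eta = crossOps mixed (quadParts kap nu the eta) := by
  rw [crossOps_mixed]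
  simp only [quadParts, coupledQ]

/-- Multiplicativity merges the four operators into those of Q_κ Q_ν and Q_θ Q_η. After expansion,
each pair (λ, μ) contributes a coupled function. -/
lemma mixed_quadParts (kap the nu eta : YoungDiagram) :
    mixed (quadParts kap nu the eta) = (structureConst kap nu).sum fun lam c =>
      (structureConst the eta).sum fun mu d => (c * d) • coupledQ lam mu := by
  have h1 : mixed (quadParts kap nu the eta) =
      (substX (Q kap * Q nu) * substY (Q the * Q eta)) 1 := by
    rw [map_mul substX, map_mul substY, ← mul_assoc]
    rfl
  rw [h1, ← linearCombination_structureConst, ← linearCombination_structureConst,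
    Finsupp.linearCombination_apply, Finsupp.linearCombination_apply, Finsupp.sum, Finsupp.sum,
    map_sum substX, map_sum substY, Finset.sum_mul_sum, LinearMap.sum_apply]
  refine Finset.sum_congr rfl fun lam _ => ?_
  rw [LinearMap.sum_apply]
  refine Finset.sum_congr rfl fun mu _ => ?_
  rw [map_smul substX, map_smul substY, smul_mul_smul_comm, LinearMap.smul_apply]
  exact congrArg _ (substX_hlSeq_substY_hlSeq (parts lam) (parts mu))

end CoupledHL

end

theorem mainTheorem4 (kap the nu eta : YoungDiagram) :
    -- the coefficients of `Q_κ Q_ν` and of `Q_θ Q_η` exist and are unique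
    (∀ f : YoungDiagram →₀ CoupledHL.K,
      Finsupp.linearCombination CoupledHL.K CoupledHL.Q f = CoupledHL.Q kap * CoupledHL.Q nu ↔
        f = CoupledHL.structureConst kap nu) ∧
    (∀ f : YoungDiagram →₀ CoupledHL.K,
      Finsupp.linearCombination CoupledHL.K CoupledHL.Q f = CoupledHL.Q the * CoupledHL.Q eta ↔
        f = CoupledHL.structureConst the eta) ∧
    -- only finitely many monomials in the operators `D` contribute to the product formula
    {k : (Fin (kap.colLen 0) × Fin (eta.colLen 0)) ⊕ (Fin (the.colLen 0) × Fin (nu.colLen 0)) → ℕ |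
      CoupledHL.mixed (CoupledHL.quadParts kap nu the eta +
        ∑ e, k e • CoupledHL.crossShift e) ≠ 0}.Finite ∧
    -- the product formula
    CoupledHL.coupledQ kap the * CoupledHL.coupledQ nu eta =
      CoupledHL.crossOps CoupledHL.mixed (CoupledHL.quadParts kap nu the eta) ∧
    CoupledHL.mixed (CoupledHL.quadParts kap nu the eta) =
      (CoupledHL.structureConst kap nu).sum fun lam c =>
        (CoupledHL.structureConst the eta).sum fun mu d =>
          (c * d) • CoupledHL.coupledQ lam mu :=
  ⟨CoupledHL.linearCombination_eq_iff kap nu, CoupledHL.linearCombination_eq_iff the eta,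
    CoupledHL.finite_crossShift _, CoupledHL.coupledQ_mul_coupledQ kap the nu eta,
    CoupledHL.mixed_quadParts kap the nu eta⟩
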